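/- Let $d\ge 0$ be an integer and $n=\lfloor d/2\rfloor$. For $a\in\mathbb R$ and $\lambda=(\lambda_1,\dots,\lambda_d)\in\mathbb R^d$ consider the Liénard system in the real plane $$\dot x=y,\qquad \dot y=-x+\Bigl(a+\sum_{i=1}^{d}\lambda_i x^i\Bigr)y. \tag{$L_{a,\lambda}$}$$ A limit cycle of this system is an isolated periodic orbit: a nonconstant periodic orbit $\Gamma$ having a neighborhood that contains no periodic orbit other than $\Gamma$. (1) (Linear part a center, $a=0$.) For every $\lambda\in\mathbb R^d$ there are a neighborhood $U$ of the origin in $\mathbb R^2$ and a neighborhood $W$ of $\lambda$ in $\mathbb R^d$ such that for every $\mu\in W$ the system $(L_{0,\mu})$ has at most $\max(n-1,0)$ limit cycles contained in $U$. (2) (Linear part perturbed to a focus.) For every $a\in\mathbb R$ (in particular for $a=0$, which covers all small perturbations of the linear center into a focus) and every $\lambda\in\mathbb R^d$ there are a neighborhood $U$ of the origin in $\mathbb R^2$ and a neighborhood $W$ of $(a,\lambda)$ in $\mathbb R\times\mathbb R^d$ such that for every $(b,\mu)\in W$ the system $(L_{b,\mu})$ has at most $n$ limit cycles contained in $U$.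 -/

import Mathlib

open Filter Topology

/-- The Liénard vector field on the real plane with parameters `a` and `lam`: writing
`lam i = λ_{i+1}` for `i = 0, …, d - 1`, it is the right-hand side of
`x' = y`, `y' = -x + (a + λ_1 x + λ_2 x ^ 2 + ⋯ + λ_d x ^ d) y`.
For `a = 0` the linear part at the origin is the linear center `x' = y`, `y' = -x`;
for `0 < |a| < 2` it is a focus. -/
def lienardField {d : ℕ} (a : ℝ) (lam : Fin d → ℝ) (z : ℝ × ℝ) : ℝ × ℝ :=
  (z.2, -z.1 + (a + ∑ i : Fin d, lam i * z.1 ^ ((i : ℕ) + 1)) * z.2)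

/-- `Γ` is a (nontrivial) periodic orbit of the planar autonomous system `z' = X z`: the image of
a nonconstant periodic solution defined for all times. -/
def IsPeriodicOrbit (X : ℝ × ℝ → ℝ × ℝ) (Γ : Set (ℝ × ℝ)) : Prop :=
  ∃ γ : ℝ → ℝ × ℝ, IsIntegralCurve γ (fun _ => X) ∧
    (∃ T : ℝ, 0 < T ∧ Function.Periodic γ T) ∧
    (∃ s t : ℝ, γ s ≠ γ t) ∧ Γ = Set.range γ

/-- A limit cycle is an isolated periodic orbit: some open set containing it contains no other
periodic orbit. -/
def IsLimitCycle (X : ℝ × ℝ → ℝ × ℝ) (Γ : Set (ℝ × ℝ)) : Prop :=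
  IsPeriodicOrbit X Γ ∧
    ∃ V : Set (ℝ × ℝ), IsOpen V ∧ Γ ⊆ V ∧
      ∀ Γ' : Set (ℝ × ℝ), IsPeriodicOrbit X Γ' → Γ' ⊆ V → Γ' = Γ

/-- The set of limit cycles of `X` that lie entirely in `U`. -/
def limitCyclesIn (X : ℝ × ℝ → ℝ × ℝ) (U : Set (ℝ × ℝ)) : Set (Set (ℝ × ℝ)) :=
  {Γ : Set (ℝ × ℝ) | IsLimitCycle X Γ ∧ Γ ⊆ U}

/-! In logarithmic polar coordinates `x = e^u sin s`, `y = e^u cos s`, a small periodic orbit is a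
graph `u` over the angle that winds once, so `t = u 0` labels it. Rescaling the plane by `e^t` moves
this label into the coefficients: up to scale, the orbit depends only on `p(t) = (c_k e^{kt})`. For
small `p` the implicit function theorem (`exists_polar_solution`) makes the half turn `0 ≤ s ≤ π`
analytic in `p`; let `R p` be its gain in logarithmic radius.

Reversing time and the sign of `x` turns the backward half turn into a forward one for `σ p`, where
`σ` (`reflectCoeff`) negates the even coefficients and fixes the odd ones. A closed orbit therefore
forces `R p = R (σ p)`. By Hadamard's lemma this reads `∑ c_k e^{kt} Ψ_k(p(t)) = 0`, the sum running
over even `k` only, with `Ψ_k 0 = ∫ sin^k cos^2 > 0` over `[0, π]`.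

Since `p(t)` is a trajectory of a linear field, `card_zeros_lt_of_exp_mul` applies: a nontrivial sum
has fewer zeros than terms. If every even coefficient vanishes, the system is reversible, its small
orbits form continuous families and none is isolated (`not_isLimitCycle_polarOrbit`). There are `n +
1` even indices up to `d`, and `n` of them once `a = 0` removes the index `0`, whence the bounds. If
`a ≠ 0`, the damping has a strict sign near the origin and no small periodic orbit exists. -/

/-! ### Counting zeros by division and derivation. -/

/-- **Rolle's theorem** for finite sets of zeros. -/
theorem exists_finset_zeros_deriv {J : Set ℝ} (hJ : J.OrdConnected) {f f' : ℝ → ℝ}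
    (hf : ∀ t ∈ J, HasDerivAt f (f' t) t) (Z : Finset ℝ) (hZJ : ↑Z ⊆ J)
    (hZ : ∀ t ∈ Z, f t = 0) :
    ∃ Z' : Finset ℝ, ↑Z' ⊆ J ∧ (∀ t ∈ Z', f' t = 0) ∧ Z.card ≤ Z'.card + 1 := by
  obtain hn | ⟨n, hn⟩ : Z.card = 0 ∨ ∃ n, Z.card = n + 1 := by
    cases h : Z.card with
    | zero => exact Or.inl rfl
    | succ n => exact Or.inr ⟨n, rfl⟩
  · exact ⟨∅, by simp, by simp, by omega⟩
  let z := Z.orderEmbOfFin hn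
  have hz : ∀ i, z i ∈ Z := fun i => Z.orderEmbOfFin_mem hn i
  have key : ∀ i : Fin n, ∃ x ∈ Set.Ioo (z i.castSucc) (z i.succ), f' x = 0 := by
    intro i
    have hlt : z i.castSucc < z i.succ := z.strictMono (Fin.castSucc_lt_succ)
    have hsub : Set.Icc (z i.castSucc) (z i.succ) ⊆ J :=
      hJ.out (hZJ (hz _)) (hZJ (hz _))
    exact exists_hasDerivAt_eq_zero hlt
      (fun x hx => (hf x (hsub hx)).continuousAt.continuousWithinAt)
      (by rw [hZ _ (hz _), hZ _ (hz _)])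
      (fun x hx => hf x (hsub (Set.Ioo_subset_Icc_self hx)))
  choose w hw hw0 using key
  have hwmono : StrictMono w := by
    intro i j hij
    have : z i.succ ≤ z j.castSucc := z.monotone (by
      rw [Fin.le_def]; simpa using hij)
    exact (hw i).2.trans_le (this.trans (hw j).1.le)
  refine ⟨Finset.univ.image w, ?_, ?_, ?_⟩
  · intro x hx
    obtain ⟨i, -, rfl⟩ := Finset.mem_image.1 (Finset.mem_coe.1 hx)
    exact hJ.out (hZJ (hz _)) (hZJ (hz _)) (Set.Ioo_subset_Icc_self (hw i))
  · intro x hx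
    obtain ⟨i, -, rfl⟩ := Finset.mem_image.1 hx
    exact hw0 i
  · rw [Finset.card_image_of_injective _ hwmono.injective]
    simp [hn]

open scoped ContDiff in
/-- **Division-derivation algorithm.** Let `y` be a trajectory of the linear vector field `L`
staying near the origin. A nontrivial combination of the functions
`t ↦ exp (e i * t) * Ψ i (y t)`, `i ∈ I`, with pairwise distinct exponents and smooth `Ψ i` not
vanishing at the origin, has fewer than `I.card` zeros. -/
theorem card_zeros_lt_of_exp_mul {P κ : Type*} [NormedAddCommGroup P] [NormedSpace ℝ P]
    [DecidableEq κ] (L : P →L[ℝ] P) (I : Finset κ) :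
    ∀ (e : κ → ℝ) (Ψ : κ → P → ℝ), Set.InjOn e I →
      (∀ i ∈ I, ContDiffAt ℝ ∞ (Ψ i) 0 ∧ Ψ i 0 ≠ 0) →
      ∀ᶠ δ : ℝ in 𝓝[>] 0, ∀ y : ℝ → P, (∀ t, HasDerivAt y (L (y t)) t) →
        ∀ J : Set ℝ, J.OrdConnected → (∀ t ∈ J, ‖y t‖ < δ) →
        ∀ c : κ → ℝ, (∃ i ∈ I, c i ≠ 0) → ∀ Z : Finset ℝ, ↑Z ⊆ J →
        (∀ t ∈ Z, ∑ i ∈ I, c i * Real.exp (e i * t) * Ψ i (y t) = 0) → Z.card < I.card := by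
  induction I using Finset.induction_on with
  | empty => 
    intro e Ψ _ _
    exact Eventually.of_forall fun δ y _ J _ _ c hc => by simp at hc
  | insert j I hj ih =>
    intro e Ψ he hΨ
    have hΨj := hΨ j (Finset.mem_insert_self _ _)
    -- Dividing by `exp (e j * t) * Ψ j` makes the `j`-th term constant, so differentiation removes
    -- it. Along `y' = L y` the other terms keep their shape, with `Ψ' i` in place of `Ψ i`; since
    -- `L 0 = 0`, the value `Ψ' i 0 = (e i - e j) * Φ i 0` is again nonzero.
    let Φ : κ → P → ℝ := fun i p => Ψ i p / Ψ j p
    let Ψ' : κ → P → ℝ := fun i p => (e i - e j) * Φ i p + fderiv ℝ (Φ i) p (L p)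
    have hΦ : ∀ i ∈ I, ContDiffAt ℝ ∞ (Φ i) 0 := fun i hi =>
      (hΨ i (Finset.mem_insert_of_mem hi)).1.div hΨj.1 hΨj.2
    have hΨ' : ∀ i ∈ I, ContDiffAt ℝ ∞ (Ψ' i) 0 ∧ Ψ' i 0 ≠ 0 := by
      intro i hi
      constructor
      · have h1 : ContDiffAt ℝ ∞ (fderiv ℝ (Φ i)) 0 := (hΦ i hi).fderiv_right (by simp)
        exact (contDiffAt_const.mul (hΦ i hi)).add (h1.clm_apply L.contDiff.contDiffAt)
      · have h1 : e i - e j ≠ 0 := by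
          rw [sub_ne_zero]
          intro h
          have := he (Finset.mem_coe.2 (Finset.mem_insert_of_mem hi))
            (Finset.mem_coe.2 (Finset.mem_insert_self _ _)) h
          exact hj (this ▸ hi)
        simp only [Ψ', Φ, map_zero, add_zero]
        exact mul_ne_zero h1 (div_ne_zero (hΨ i (Finset.mem_insert_of_mem hi)).2 hΨj.2)
    have ih' := ih (fun i => e i - e j) Ψ' (fun a ha b hb hab =>
      he (Finset.mem_coe.2 (Finset.mem_insert_of_mem ha))
        (Finset.mem_coe.2 (Finset.mem_insert_of_mem hb)) (sub_left_injective hab)) hΨ'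
    have hnh : ∀ᶠ p in 𝓝 (0 : P), Ψ j p ≠ 0 ∧ ∀ i ∈ I, DifferentiableAt ℝ (Φ i) p := by
      refine (hΨj.1.continuousAt.eventually_ne hΨj.2).and ?_
      rw [Filter.eventually_all_finset]
      intro i hi
      have : ContDiffAt ℝ 1 (Φ i) 0 := (hΦ i hi).of_le (by exact_mod_cast le_top)
      exact (this.eventually (by simp)).mono fun p hp => hp.differentiableAt (by simp)
    obtain ⟨ρ, hρ, hρN⟩ := Metric.eventually_nhds_iff.1 hnh
    have hρ' : ∀ᶠ δ : ℝ in 𝓝[>] 0, δ < ρ := nhdsWithin_le_nhds (eventually_lt_nhds hρ)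
    filter_upwards [ih', hρ'] with δ hδ hδρ y hy J hJ hyJ c hc Z hZJ hZ
    have hyN : ∀ t ∈ J, Ψ j (y t) ≠ 0 ∧ ∀ i ∈ I, DifferentiableAt ℝ (Φ i) (y t) := fun t ht =>
      hρN (by simpa using (hyJ t ht).trans hδρ)
    rw [Finset.card_insert_of_notMem hj]
    let f : ℝ → ℝ := fun t => c j + ∑ i ∈ I, c i * Real.exp ((e i - e j) * t) * Φ i (y t)
    have hfZ : ∀ t ∈ Z, f t = 0 := by
      intro t ht
      have h1 := hZ t ht
      have h2 := (hyN t (hZJ ht)).1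
      have h3 : Real.exp (e j * t) ≠ 0 := (Real.exp_pos _).ne'
      have h4 : f t * (Real.exp (e j * t) * Ψ j (y t)) = 0 := by
        rw [← h1, Finset.sum_insert hj, add_mul, Finset.sum_mul]
        congr 1
        · ring
        · refine Finset.sum_congr rfl fun i _ => ?_
          have : Real.exp (e i * t) = Real.exp ((e i - e j) * t) * Real.exp (e j * t) := by
            rw [← Real.exp_add]; ring_nf
          rw [this]
          simp only [Φ]
          field_simp
      exact (mul_eq_zero.1 h4).resolve_right (mul_ne_zero h3 h2)
    by_cases hcI : ∃ i ∈ I, c i ≠ 0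
    · have hf : ∀ t ∈ J, HasDerivAt f
          (∑ i ∈ I, c i * Real.exp ((e i - e j) * t) * Ψ' i (y t)) t := by
        intro t ht
        refine HasDerivAt.const_add _ (HasDerivAt.fun_sum fun i hi => ?_)
        have h1 : HasDerivAt (fun t => Φ i (y t)) (fderiv ℝ (Φ i) (y t) (L (y t))) t :=
          ((hyN t ht).2 i hi).hasFDerivAt.comp_hasDerivAt t (hy t)
        have h2 : HasDerivAt (fun t => Real.exp ((e i - e j) * t))
            (Real.exp ((e i - e j) * t) * ((e i - e j) * 1)) t :=
          ((hasDerivAt_id t).const_mul _).exp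
        refine ((h2.const_mul (c i)).mul h1).congr_deriv ?_
        simp only [Ψ']
        ring
      obtain ⟨Z', hZ'J, hZ', hcard⟩ := exists_finset_zeros_deriv hJ hf Z hZJ hfZ
      have := hδ y hy J hJ hyJ c hcI Z' hZ'J hZ'
      omega
    -- Only the `j`-th coefficient survives, so the quotient `f` is a nonzero constant and Rolle's
    -- theorem is not needed.
    · push Not at hcI
      obtain ⟨i, hi, hci⟩ := hc
      have hij : c j ≠ 0 := by
        rcases Finset.mem_insert.1 hi with rfl | h
        · exact hci
        · exact absurd (hcI i h) hci
      have : Z = ∅ := by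
        refine Finset.eq_empty_of_forall_notMem fun t ht => hij ?_
        have h1 : ∑ i ∈ I, c i * Real.exp ((e i - e j) * t) * Φ i (y t) = 0 :=
          Finset.sum_eq_zero fun i hi => by rw [hcI i hi]; ring
        simpa only [f, h1, add_zero] using hfZ t ht
      simp [this]

/-! ### Parameter integrals and Hadamard's lemma. -/

open scoped ContDiff in
/-- Differentiation under the integral sign over a compact interval. -/
theorem hasFDerivAt_intervalIntegral_of_contDiffOn {P F : Type*} [NormedAddCommGroup P]
    [NormedSpace ℝ P] [ProperSpace P] [NormedAddCommGroup F] [NormedSpace ℝ F] [CompleteSpace F]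
    {s : Set P} {u : Set ℝ} (hs : IsOpen s) (hu : IsOpen u) {a b : ℝ}
    (hab : Set.uIcc a b ⊆ u) {f : P × ℝ → F} (hf : ContDiffOn ℝ 1 f (s ×ˢ u)) {p : P} (hp : p ∈ s) :
    HasFDerivAt (fun p => ∫ t in a..b, f (p, t))
      (∫ t in a..b, (fderiv ℝ f (p, t)).comp (ContinuousLinearMap.inl ℝ P ℝ)) p := by
  obtain ⟨r, hr, hrs⟩ := Metric.nhds_basis_closedBall.mem_iff.1 (hs.mem_nhds hp)
  have hopen : IsOpen (s ×ˢ u) := hs.prod hu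
  have hf' : ContinuousOn (fun q => (fderiv ℝ f q).comp (ContinuousLinearMap.inl ℝ P ℝ))
      (s ×ˢ u) := by
    have h1 : ContinuousOn (fderiv ℝ f) (s ×ˢ u) := hf.continuousOn_fderiv_of_isOpen hopen (by simp)
    exact h1.clm_comp continuousOn_const
  have hK : IsCompact (Metric.closedBall p r ×ˢ Set.uIcc a b) :=
    (isCompact_closedBall p r).prod isCompact_uIcc
  have hKsub : Metric.closedBall p r ×ˢ Set.uIcc a b ⊆ s ×ˢ u := Set.prod_mono hrs hab
  obtain ⟨C, hC⟩ := hK.exists_bound_of_continuousOn (hf'.mono hKsub)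
  have hslice : ∀ x ∈ Metric.closedBall p r, ContinuousOn (fun t => f (x, t)) (Set.uIcc a b) :=
    fun x hx => hf.continuousOn.comp (by fun_prop) fun t ht => hKsub ⟨hx, ht⟩
  have hslice' : ContinuousOn
      (fun t => (fderiv ℝ f (p, t)).comp (ContinuousLinearMap.inl ℝ P ℝ)) (Set.uIcc a b) :=
    hf'.comp (by fun_prop) fun t ht => hKsub ⟨Metric.mem_closedBall_self hr.le, ht⟩
  refine intervalIntegral.hasFDerivAt_integral_of_dominated_of_fderiv_le (μ := MeasureTheory.volume)
    (F := fun p t => f (p, t)) (bound := fun _ => C)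
    (F' := fun p t => (fderiv ℝ f (p, t)).comp (ContinuousLinearMap.inl ℝ P ℝ))
    (Metric.ball_mem_nhds p hr) ?_ ?_ ?_ ?_ ?_ ?_
  · filter_upwards [Metric.ball_mem_nhds p hr] with x hx
    exact (intervalIntegrable_iff.1
      (hslice x (Metric.ball_subset_closedBall hx)).intervalIntegrable).aestronglyMeasurable
  · exact (hslice p (Metric.mem_closedBall_self hr.le)).intervalIntegrable
  · exact (intervalIntegrable_iff.1 hslice'.intervalIntegrable).aestronglyMeasurable
  · refine Eventually.of_forall fun t ht x hx => ?_
    exact hC (x, t) ⟨Metric.ball_subset_closedBall hx, Set.uIoc_subset_uIcc ht⟩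
  · exact intervalIntegrable_const
  · refine Eventually.of_forall fun t ht x hx => ?_
    have hmem : (x, t) ∈ s ×ˢ u :=
      hKsub ⟨Metric.ball_subset_closedBall hx, Set.uIoc_subset_uIcc ht⟩
    have h1 : HasFDerivAt f (fderiv ℝ f (x, t)) (x, t) :=
      ((hf.contDiffAt (hopen.mem_nhds hmem)).differentiableAt (by simp)).hasFDerivAt
    exact h1.comp x (hasFDerivAt_prodMk_left x t)

open scoped ContDiff in
/-- An integral over a compact interval depends smoothly on parameters. -/
theorem contDiffOn_intervalIntegral {P : Type} [NormedAddCommGroup P]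
    [NormedSpace ℝ P] [ProperSpace P]
    {s : Set P} {u : Set ℝ} (hs : IsOpen s) (hu : IsOpen u) {a b : ℝ}
    (hab : Set.uIcc a b ⊆ u) (n : ℕ) :
    ∀ {F : Type} [NormedAddCommGroup F] [NormedSpace ℝ F] [CompleteSpace F] {f : P × ℝ → F},
      ContDiffOn ℝ ∞ f (s ×ˢ u) → ContDiffOn ℝ n (fun p => ∫ t in a..b, f (p, t)) s := by
  induction n with
  | zero =>
    intro F _ _ _ f hf
    refine contDiffOn_zero.2 fun p hp => ?_
    exact (hasFDerivAt_intervalIntegral_of_contDiffOn hs hu hab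
      (hf.of_le (by exact_mod_cast le_top)) hp).continuousAt.continuousWithinAt
  | succ n ih =>
    intro F _ _ _ f hf
    have hd := fun p hp => hasFDerivAt_intervalIntegral_of_contDiffOn hs hu hab
      (hf.of_le (by exact_mod_cast le_top)) (p := p) hp
    rw [Nat.cast_succ, contDiffOn_succ_iff_fderiv_of_isOpen hs]
    refine ⟨fun p hp => (hd p hp).differentiableAt.differentiableWithinAt, by simp, ?_⟩
    have h1 : ContDiffOn ℝ ∞ (fderiv ℝ f) (s ×ˢ u) :=
      hf.fderiv_of_isOpen (hs.prod hu) (by simp)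
    exact (ih (f := fun q => (fderiv ℝ f q).comp (ContinuousLinearMap.inl ℝ P ℝ))
      (h1.clm_comp contDiffOn_const)).congr fun p hp => (hd p hp).fderiv

open scoped ContDiff in
/-- **Hadamard's lemma**: the increment of a function between `σ p` and `p` is a smooth linear form
in `p - σ p`. -/
theorem exists_increment_eq_clm_apply {P : Type} [NormedAddCommGroup P] [NormedSpace ℝ P]
    [ProperSpace P] (σ : P →L[ℝ] P) {R : P → ℝ} (hR : ContDiffAt ℝ ω R 0) :
    ∃ Φ : P → (P →L[ℝ] ℝ), ContDiffAt ℝ ∞ Φ 0 ∧ Φ 0 = fderiv ℝ R 0 ∧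
      ∀ᶠ p in 𝓝 0, R p - R (σ p) = Φ p (p - σ p) := by
  obtain ⟨r, hr, hrR⟩ := Metric.eventually_nhds_iff_ball.1 (hR.eventually (by simp))
  let m : P × ℝ → P := fun q => σ q.1 + q.2 • (q.1 - σ q.1)
  have hm : ContDiff ℝ ω m := by fun_prop
  -- `R` is only known to be analytic on a ball, so `p` is restricted until the whole segment from
  -- `σ p` to `p` lies there. The parameter set `u` is open and contains `[0, 1]`.
  obtain ⟨s, u, hs, hu, h0s, hIu, hsu⟩ := generalized_tube_lemma (s := {(0 : P)})
    (t := Set.uIcc (0 : ℝ) 1) isCompact_singleton isCompact_uIcc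
    (n := m ⁻¹' Metric.ball 0 r) (Metric.isOpen_ball.preimage hm.continuous) (by
      rintro ⟨p, t⟩ ⟨hp, -⟩
      rw [Set.mem_singleton_iff] at hp
      simp only at hp
      simp [m, hp, hr])
  have h0 : (0 : P) ∈ s := h0s rfl
  have hRon : ContDiffOn ℝ ω R (Metric.ball 0 r) := fun p hp => (hrR p hp).contDiffWithinAt
  have hdR : ContDiffOn ℝ ω (fderiv ℝ R) (Metric.ball 0 r) :=
    hRon.fderiv_of_isOpen Metric.isOpen_ball (by simp)
  have hcomp : ContDiffOn ℝ ω (fun q => fderiv ℝ R (m q)) (s ×ˢ u) :=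
    hdR.comp hm.contDiffOn fun q hq => hsu hq
  refine ⟨fun p => ∫ t in (0 : ℝ)..1, fderiv ℝ R (m (p, t)), ?_, ?_, ?_⟩
  · rw [contDiffAt_infty]
    intro n
    exact (contDiffOn_intervalIntegral hs hu hIu n (hcomp.of_le (by simp))).contDiffAt
      (hs.mem_nhds h0)
  · simp [m]
  · filter_upwards [hs.mem_nhds h0] with p hp
    have hcont : ContinuousOn (fun t : ℝ => fderiv ℝ R (m (p, t))) (Set.uIcc 0 1) :=
      hcomp.continuousOn.comp (by fun_prop) fun t ht => ⟨hp, hIu ht⟩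
    rw [ContinuousLinearMap.intervalIntegral_apply hcont.intervalIntegrable]
    have hderiv : ∀ t ∈ Set.uIcc (0 : ℝ) 1,
        HasDerivAt (fun t => R (m (p, t))) (fderiv ℝ R (m (p, t)) (p - σ p)) t := by
      intro t ht
      have h1 : HasDerivAt (fun t : ℝ => m (p, t)) (p - σ p) t := by
        have := ((hasDerivAt_id t).smul_const (p - σ p)).const_add (σ p)
        simpa [m] using this
      have h2 := ((hrR (m (p, t)) (hsu (Set.mk_mem_prod hp (hIu ht)))).differentiableAt (by simp)).hasFDerivAt
      exact h2.comp_hasDerivAt t h1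
    rw [intervalIntegral.integral_eq_sub_of_hasDerivAt hderiv
      (hcont.clm_apply continuousOn_const).intervalIntegrable]
    simp [m]

/-! ### The half turn as the solution of an implicit equation. -/

open scoped BoundedContinuousFunction

/-- The distance from an angle to the nearest multiple of `2π`, in `[0, π]`. -/
noncomputable def foldAngle (s : ℝ) : ℝ := Real.arccos (Real.cos s)

theorem foldAngle_nonneg (s : ℝ) : 0 ≤ foldAngle s := Real.arccos_nonneg _

theorem foldAngle_le_pi (s : ℝ) : foldAngle s ≤ Real.pi := Real.arccos_le_pi _

theorem foldAngle_of_mem {s : ℝ} (h0 : 0 ≤ s) (h1 : s ≤ Real.pi) : foldAngle s = s :=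
  Real.arccos_cos h0 h1

theorem cos_foldAngle (s : ℝ) : Real.cos (foldAngle s) = Real.cos s :=
  Real.cos_arccos (Real.neg_one_le_cos s) (Real.cos_le_one s)

theorem continuous_foldAngle : Continuous foldAngle :=
  Real.continuous_arccos.comp Real.continuous_cos

/-- Folding keeps the upper limit in `[0, π]`, so primitives stay bounded. The half-turn problem can
then be posed in the Banach algebra of bounded continuous functions on the whole line. -/
theorem norm_integral_foldAngle_le (g : ℝ →ᵇ ℝ) (s : ℝ) :
    ‖∫ σ in (0 : ℝ)..foldAngle s, g σ‖ ≤ ‖g‖ * Real.pi := by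
  refine (intervalIntegral.norm_integral_le_of_norm_le_const
    (fun x _ => g.norm_coe_le_norm x)).trans ?_
  rw [sub_zero, abs_of_nonneg (foldAngle_nonneg s)]
  gcongr
  exact foldAngle_le_pi s

/-- Integration from `0` to the folded angle, as a bounded operator. -/
noncomputable def foldIntegral : (ℝ →ᵇ ℝ) →L[ℝ] (ℝ →ᵇ ℝ) :=
  LinearMap.mkContinuous
    { toFun := fun g => BoundedContinuousFunction.ofNormedAddCommGroup
        (fun s => ∫ σ in (0 : ℝ)..foldAngle s, g σ)
        ((intervalIntegral.continuous_primitive (fun a b => g.continuous.intervalIntegrable a b)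
          0).comp continuous_foldAngle)
        (‖g‖ * Real.pi) (norm_integral_foldAngle_le g)
      map_add' := fun f g => by
        ext s
        exact intervalIntegral.integral_add (f.continuous.intervalIntegrable _ _)
          (g.continuous.intervalIntegrable _ _)
      map_smul' := fun r f => by
        ext s
        exact intervalIntegral.integral_const_mul r f }
    Real.pi (fun g => by
      rw [mul_comm]
      exact BoundedContinuousFunction.norm_ofNormedAddCommGroup_le _ (by positivity)
        (norm_integral_foldAngle_le g))

theorem foldIntegral_apply (g : ℝ →ᵇ ℝ) (s : ℝ) :
    foldIntegral g s = ∫ σ in (0 : ℝ)..foldAngle s, g σ := rfl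

/-- The function `s ↦ |sin s|`. -/
noncomputable def sinFold : ℝ →ᵇ ℝ :=
  BoundedContinuousFunction.ofNormedAddCommGroup (fun s => Real.sin (foldAngle s))
    (Real.continuous_sin.comp continuous_foldAngle) 1 fun _ => Real.abs_sin_le_one _

/-- The cosine as a bounded continuous function. -/
noncomputable def cosBounded : ℝ →ᵇ ℝ :=
  BoundedContinuousFunction.ofNormedAddCommGroup Real.cos Real.continuous_cos 1
    fun _ => Real.abs_cos_le_one _

theorem sinFold_apply (s : ℝ) : sinFold s = Real.sin (foldAngle s) := rfl

theorem cosBounded_apply (s : ℝ) : cosBounded s = Real.cos s := rfl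

/-- Evaluation is a continuous ring homomorphism, hence commutes with the exponential series. Using
the Banach algebra exponential gives analyticity of `polarTerm` at once. -/
theorem BoundedContinuousFunction.exp_apply (f : ℝ →ᵇ ℝ) (s : ℝ) :
    (NormedSpace.exp f) s = Real.exp (f s) := by
  let ev : (ℝ →ᵇ ℝ) →+* ℝ :=
    { toFun := fun f => f s
      map_one' := rfl
      map_mul' := fun _ _ => rfl
      map_zero' := rfl
      map_add' := fun _ _ => rfl }
  have h := NormedSpace.map_exp ev (BoundedContinuousFunction.evalCLM ℝ s).continuous f
  rw [Real.exp_eq_exp_ℝ]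
  exact h

/-- The `k`-th component of the vector field `du/ds` in logarithmic polar coordinates. -/
noncomputable def polarTerm (k : ℕ) (g : ℝ →ᵇ ℝ) : ℝ →ᵇ ℝ :=
  (sinFold * NormedSpace.exp (foldIntegral g)) ^ k *
    (cosBounded ^ 2 + sinFold * cosBounded * g)

/-- The implicit equation satisfied by the derivative `g = du/ds` of a half turn of an orbit, with
scaled coefficients `p`. -/
noncomputable def polarDefect {m : ℕ} (q : (Fin m → ℝ) × (ℝ →ᵇ ℝ)) : ℝ →ᵇ ℝ :=
  q.2 - ∑ k, q.1 k • polarTerm k q.2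

open scoped ContDiff in
theorem contDiff_polarTerm (k : ℕ) : ContDiff ℝ ω (polarTerm k) := by
  have h1 : ContDiff ℝ ω (fun g : ℝ →ᵇ ℝ => NormedSpace.exp (foldIntegral g)) := by
    have : ContDiff ℝ ω (NormedSpace.exp : (ℝ →ᵇ ℝ) → (ℝ →ᵇ ℝ)) :=
      contDiff_iff_contDiffAt.2 fun x => (NormedSpace.exp_analytic (𝕂 := ℝ) x).contDiffAt
    exact this.comp foldIntegral.contDiff
  unfold polarTerm
  exact ((contDiff_const.mul h1).pow k).mul
    (contDiff_const.add (contDiff_const.mul contDiff_id))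

theorem polarTerm_zero (k : ℕ) : polarTerm k 0 = sinFold ^ k * cosBounded ^ 2 := by
  simp [polarTerm]

open scoped ContDiff in
theorem contDiff_polarDefect (m : ℕ) :
    ContDiff ℝ ω (polarDefect : (Fin m → ℝ) × (ℝ →ᵇ ℝ) → (ℝ →ᵇ ℝ)) := by
  unfold polarDefect
  refine contDiff_snd.sub (ContDiff.sum fun k _ => ?_)
  have h1 : ContDiff ℝ ω (fun q : (Fin m → ℝ) × (ℝ →ᵇ ℝ) => q.1 k) :=
    (contDiff_apply ℝ ℝ k).comp contDiff_fst
  exact h1.smul ((contDiff_polarTerm k).comp contDiff_snd)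

/-- The sum is linear in the coefficients, which vanish at the base point, so `g` contributes only
the identity there. This is the invertibility that the implicit function theorem needs. -/
theorem hasFDerivAt_polarDefect_zero (m : ℕ) :
    HasFDerivAt (polarDefect : (Fin m → ℝ) × (ℝ →ᵇ ℝ) → (ℝ →ᵇ ℝ))
      (ContinuousLinearMap.snd ℝ (Fin m → ℝ) (ℝ →ᵇ ℝ) -
        ∑ k, ((ContinuousLinearMap.proj k).comp
          (ContinuousLinearMap.fst ℝ (Fin m → ℝ) (ℝ →ᵇ ℝ))).smulRight
            (sinFold ^ (k : ℕ) * cosBounded ^ 2)) 0 := by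
  unfold polarDefect
  refine hasFDerivAt_snd.sub (HasFDerivAt.fun_sum fun k _ => ?_)
  have h1 : HasFDerivAt (fun q : (Fin m → ℝ) × (ℝ →ᵇ ℝ) => q.1 k)
      ((ContinuousLinearMap.proj k).comp
          (ContinuousLinearMap.fst ℝ (Fin m → ℝ) (ℝ →ᵇ ℝ))) 0 :=
    ((ContinuousLinearMap.proj (R := ℝ) (φ := fun _ : Fin m => ℝ) k).comp
      (ContinuousLinearMap.fst ℝ (Fin m → ℝ) (ℝ →ᵇ ℝ))).hasFDerivAt
  have h2 : DifferentiableAt ℝ (fun q : (Fin m → ℝ) × (ℝ →ᵇ ℝ) => polarTerm k q.2) 0 :=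
    (((contDiff_polarTerm k).comp contDiff_snd).differentiable (by simp)) 0
  refine (h1.smul h2.hasFDerivAt).congr_fderiv ?_
  simp [polarTerm_zero]

open scoped ContDiff in
/-- Small scaled coefficients determine the half turn analytically. -/
theorem exists_polar_solution (m : ℕ) :
    ∃ γ : (Fin m → ℝ) → (ℝ →ᵇ ℝ), ContDiffAt ℝ ω γ 0 ∧ γ 0 = 0 ∧
      (∀ k, fderiv ℝ γ 0 (Pi.single k 1) = sinFold ^ (k : ℕ) * cosBounded ^ 2) ∧
      ∀ᶠ q in 𝓝 (0 : (Fin m → ℝ) × (ℝ →ᵇ ℝ)), polarDefect q = 0 ↔ γ q.1 = q.2 := by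
  have hF := (contDiff_polarDefect m).contDiffAt (x := 0)
  have hfd := (hasFDerivAt_polarDefect_zero m).fderiv
  have h2 : fderiv ℝ polarDefect (0 : (Fin m → ℝ) × (ℝ →ᵇ ℝ)) ∘L
      .inr ℝ (Fin m → ℝ) (ℝ →ᵇ ℝ) = ContinuousLinearMap.id ℝ _ := by
    rw [hfd]
    ext g s
    simp
  have hinv : (fderiv ℝ polarDefect (0 : (Fin m → ℝ) × (ℝ →ᵇ ℝ)) ∘L
      .inr ℝ (Fin m → ℝ) (ℝ →ᵇ ℝ)).IsInvertible := by
    rw [h2]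
    exact ⟨ContinuousLinearEquiv.refl ℝ _, rfl⟩
  have h0 : polarDefect (0 : (Fin m → ℝ) × (ℝ →ᵇ ℝ)) = 0 := by simp [polarDefect]
  refine ⟨hF.implicitFunction (by simp) hinv, hF.contDiffAt_implicitFunction (by simp) hinv,
    hF.implicitFunction_apply_self (by simp) hinv, fun k => ?_, ?_⟩
  · have h3 := (hF.hasStrictFDerivAt_implicitFunction (by simp) hinv).hasFDerivAt.fderiv
    have h4 : (0 : (Fin m → ℝ) × (ℝ →ᵇ ℝ)).1 = 0 := rfl
    rw [h4] at h3
    rw [h3, h2, ContinuousLinearMap.inverse_id, hfd]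
    simp only [ContinuousLinearMap.comp_apply, neg_apply,
      ContinuousLinearMap.id_apply, ContinuousLinearMap.inl_apply, sub_apply,
      ContinuousLinearMap.coe_snd', zero_sub, sum_apply,
      ContinuousLinearMap.smulRight_apply, ContinuousLinearMap.coe_fst',
      ContinuousLinearMap.proj_apply, neg_neg]
    rw [Finset.sum_eq_single k]
    · simp
    · intro b _ hb
      simp [Pi.single_eq_of_ne hb]
    · simp
  · have := hF.eventually_apply_eq_iff_implicitFunction (by simp) hinv
    rw [h0] at this
    exact this

theorem integral_sin_pow_mul_cos_sq_pos (k : ℕ) :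
    0 < ∫ s in (0 : ℝ)..Real.pi, Real.sin s ^ k * Real.cos s ^ 2 := by
  have hpi := Real.pi_pos
  refine intervalIntegral.integral_pos hpi (by fun_prop) (fun x hx => ?_)
    ⟨Real.pi / 4, ⟨by linarith, by linarith⟩, ?_⟩
  · have := Real.sin_nonneg_of_nonneg_of_le_pi hx.1.le hx.2
    positivity
  · rw [Real.sin_pi_div_four, Real.cos_pi_div_four]
    positivity

/-! ### Polar coordinates: small periodic orbits wind once. -/

/-- A strictly expanding primitive has a differentiable inverse. -/
theorem exists_hasDerivAt_inverse {f f' : ℝ → ℝ} {m : ℝ} (hm : 0 < m)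
    (hf : ∀ t, HasDerivAt f (f' t) t) (hf' : ∀ t, m ≤ f' t) :
    ∃ τ : ℝ → ℝ, (∀ s, f (τ s) = s) ∧ (∀ t, τ (f t) = t) ∧
      ∀ s, HasDerivAt τ (f' (τ s))⁻¹ s := by
  have hmono : StrictMono f := strictMono_of_hasDerivAt_pos hf fun t => hm.trans_le (hf' t)
  have hcont : Continuous f := continuous_iff_continuousAt.2 fun t => (hf t).continuousAt
  have hgrow : ∀ ⦃x y : ℝ⦄, x ≤ y → m * (y - x) ≤ f y - f x :=
    mul_sub_le_image_sub_of_le_deriv (fun t => (hf t).differentiableAt)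
      fun t => (hf t).deriv.symm ▸ hf' t
  have hsurj : Function.Surjective f := by
    intro s
    refine mem_range_of_exists_le_of_exists_ge hcont ⟨-(|s - f 0| / m), ?_⟩ ⟨|s - f 0| / m, ?_⟩
    · have h := hgrow (x := -(|s - f 0| / m)) (y := 0) (by simp; positivity)
      have : m * (|s - f 0| / m) = |s - f 0| := by field_simp
      have := neg_abs_le (s - f 0)
      nlinarith
    · have h := hgrow (x := 0) (y := |s - f 0| / m) (by positivity)
      have : m * (|s - f 0| / m) = |s - f 0| := by field_simp
      have := le_abs_self (s - f 0)
      nlinarith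
  let e := hmono.orderIsoOfSurjective f hsurj
  have h1 : ∀ s, f (e.symm s) = s := fun s => e.apply_symm_apply s
  have h2 : ∀ t, e.symm (f t) = t := fun t => e.symm_apply_apply t
  refine ⟨e.symm, h1, h2, fun s => ?_⟩
  exact HasDerivAt.of_local_left_inverse e.symm.continuous.continuousAt (hf _)
    (hm.trans_le (hf' _)).ne' (Eventually.of_forall h1)

theorem eq_of_hasDerivAt_zero {f : ℝ → ℝ} (hf : ∀ t, HasDerivAt f 0 t) (s t : ℝ) : f s = f t :=
  is_const_of_deriv_eq_zero (fun t => (hf t).differentiableAt) (fun t => (hf t).deriv) s t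

/-- A function whose derivative is `T`-periodic increases by a fixed amount over each period. -/
theorem eq_add_of_periodic_deriv {f f' : ℝ → ℝ} {T : ℝ} (hf : ∀ t, HasDerivAt f (f' t) t)
    (hT : ∀ t, f' (t + T) = f' t) (t₀ t : ℝ) : f (t + T) = f t + (f (t₀ + T) - f t₀) := by
  have h : ∀ t, HasDerivAt (fun t => f (t + T) - f t) 0 t := fun t => by
    have := ((hf (t + T)).comp_add_const t T).sub (hf t)
    rwa [hT, sub_self] at this
  have := eq_of_hasDerivAt_zero h t t₀
  linarith

/-- The damping coefficient `∑ c_k x ^ k`. -/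
def damping {m : ℕ} (c : Fin m → ℝ) (x : ℝ) : ℝ := ∑ k, c k * x ^ (k : ℕ)

/-- The vector field `x' = y`, `y' = -x + (∑ c_k x ^ k) y`. -/
def dampedField {m : ℕ} (c : Fin m → ℝ) (z : ℝ × ℝ) : ℝ × ℝ :=
  (z.2, -z.1 + damping c z.1 * z.2)

theorem lienardField_eq_dampedField {d : ℕ} (a : ℝ) (lam : Fin d → ℝ) :
    lienardField a lam = dampedField (Fin.cons a lam : Fin (d + 1) → ℝ) := by
  funext z
  simp [lienardField, dampedField, damping, Fin.sum_univ_succ]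

theorem continuous_damping {m : ℕ} (c : Fin m → ℝ) : Continuous (damping c) := by
  unfold damping
  fun_prop

/-- The point with logarithmic polar coordinates `(u, s)`. -/
noncomputable def polarPoint (u s : ℝ) : ℝ × ℝ :=
  (Real.exp u * Real.sin s, Real.exp u * Real.cos s)

theorem polarPoint_ne_zero (u s : ℝ) : polarPoint u s ≠ 0 := by
  intro h
  have h1 := congrArg Prod.fst h
  have h2 := congrArg Prod.snd h
  simp only [polarPoint, Prod.fst_zero, Prod.snd_zero] at h1 h2
  have := Real.sin_sq_add_cos_sq s
  have h3 := (Real.exp_pos u).ne'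
  rw [(mul_eq_zero.1 h1).resolve_left h3, (mul_eq_zero.1 h2).resolve_left h3] at this
  norm_num at this

/-- `u` describes, in logarithmic polar coordinates, a closed orbit of `dampedField c` winding once
around the origin. -/
structure IsPolarOrbit {m : ℕ} (c : Fin m → ℝ) (u : ℝ → ℝ) : Prop where
  exists_deriv : ∀ s, ∃ g, HasDerivAt u g s ∧
    g = damping c (Real.exp (u s) * Real.sin s) *
      (Real.cos s ^ 2 + Real.sin s * Real.cos s * g)
  periodic : Function.Periodic u (2 * Real.pi)

/-- The orbit with radius function `exp ∘ u`. -/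
def polarOrbit (u : ℝ → ℝ) : Set (ℝ × ℝ) := Set.range fun s => polarPoint (u s) s

section Planar

variable {m : ℕ} {c : Fin m → ℝ}

theorem contDiff_dampedField : ContDiff ℝ 1 (dampedField c) := by
  unfold dampedField damping
  fun_prop

/-- Bounded integral curves with a common point coincide. -/
theorem IsIntegralCurve.eq_of_eq_at {γ₁ γ₂ : ℝ → ℝ × ℝ}
    (h₁ : IsIntegralCurve γ₁ (fun _ => dampedField c))
    (h₂ : IsIntegralCurve γ₂ (fun _ => dampedField c)) {M : ℝ} (hM₁ : ∀ t, ‖γ₁ t‖ ≤ M)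
    (hM₂ : ∀ t, ‖γ₂ t‖ ≤ M) {t₀ : ℝ} (h : γ₁ t₀ = γ₂ t₀) : γ₁ = γ₂ := by
  obtain ⟨K, hK⟩ := (contDiff_dampedField (c := c)).locallyLipschitz.locallyLipschitzOn
    |>.exists_lipschitzOnWith_of_compact (isCompact_closedBall (0 : ℝ × ℝ) M)
  exact ODE_solution_unique_univ (v := fun _ => dampedField c)
    (s := fun _ => Metric.closedBall 0 M) (fun _ => hK)
    (fun t => ⟨h₁ t, by simpa using hM₁ t⟩) (fun t => ⟨h₂ t, by simpa using hM₂ t⟩) h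

theorem IsIntegralCurve.hasDerivAt_fst {γ : ℝ → ℝ × ℝ}
    (hγ : IsIntegralCurve γ (fun _ => dampedField c)) (t : ℝ) :
    HasDerivAt (fun t => (γ t).1) (γ t).2 t :=
  (hasFDerivAt_fst (𝕜 := ℝ) (E := ℝ) (F := ℝ) (p := γ t)).comp_hasDerivAt t (hγ t)

theorem IsIntegralCurve.hasDerivAt_snd {γ : ℝ → ℝ × ℝ}
    (hγ : IsIntegralCurve γ (fun _ => dampedField c)) (t : ℝ) :
    HasDerivAt (fun t => (γ t).2) (-(γ t).1 + damping c (γ t).1 * (γ t).2) t :=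
  (hasFDerivAt_snd (𝕜 := ℝ) (E := ℝ) (F := ℝ) (p := γ t)).comp_hasDerivAt t (hγ t)

/-- The angular velocity of `dampedField c`. -/
noncomputable def angularSpeed {m : ℕ} (c : Fin m → ℝ) (z : ℝ × ℝ) : ℝ :=
  1 - damping c z.1 * (z.1 * z.2 / (z.1 ^ 2 + z.2 ^ 2))

theorem sq_add_sq_pos_of_ne_zero {z : ℝ × ℝ} (hz : z ≠ 0) : 0 < z.1 ^ 2 + z.2 ^ 2 := by
  by_contra h
  refine hz (Prod.ext ?_ ?_)
  · simp only [Prod.fst_zero]; nlinarith [sq_nonneg z.1, sq_nonneg z.2]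
  · simp only [Prod.snd_zero]; nlinarith [sq_nonneg z.1, sq_nonneg z.2]

theorem continuous_angularSpeed {α : Type*} [TopologicalSpace α] {f : α → ℝ × ℝ}
    (hf : Continuous f) (h0 : ∀ a, f a ≠ 0) : Continuous fun a => angularSpeed c (f a) := by
  unfold angularSpeed
  have := continuous_damping c
  refine continuous_const.sub ((this.comp (by fun_prop)).mul (Continuous.div ?_ ?_ ?_))
  · fun_prop
  · fun_prop
  · exact fun a => (sq_add_sq_pos_of_ne_zero (h0 a)).ne'

/-- Here `|xy| ≤ x² + y²`, so small damping cannot stop the rotation and the angle can replace time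
as parameter. -/
theorem le_angularSpeed {z : ℝ × ℝ} (hz : z ≠ 0) (hq : |damping c z.1| ≤ 1 / 2) :
    1 / 2 ≤ angularSpeed c z := by
  have hE := sq_add_sq_pos_of_ne_zero hz
  have h1 : |z.1 * z.2 / (z.1 ^ 2 + z.2 ^ 2)| ≤ 1 := by
    rw [abs_div, abs_of_pos hE, div_le_one hE, abs_le]
    constructor <;> nlinarith [sq_nonneg (z.1 + z.2), sq_nonneg (z.1 - z.2)]
  have h2 := mul_le_mul hq h1 (abs_nonneg _) (by norm_num)
  rw [← abs_mul] at h2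
  unfold angularSpeed
  linarith [le_abs_self (damping c z.1 * (z.1 * z.2 / (z.1 ^ 2 + z.2 ^ 2)))]

/-- With `q` the damping, `θ' = 1 - q sin θ cos θ` and `ℓ' = q cos² θ`; clearing the denominator in
`g = ℓ' / θ'` gives the equation in `IsPolarOrbit`. -/
theorem angularSpeed_polarPoint (u s : ℝ) :
    angularSpeed c (polarPoint u s) =
      1 - damping c (Real.exp u * Real.sin s) * (Real.sin s * Real.cos s) := by
  have h : (Real.exp u * Real.sin s) ^ 2 + (Real.exp u * Real.cos s) ^ 2 = Real.exp u ^ 2 := by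
    linear_combination Real.exp u ^ 2 * Real.sin_sq_add_cos_sq s
  have := (Real.exp_pos u).ne'
  simp only [angularSpeed, polarPoint, h]
  congr 2
  field_simp

/-- Logarithmic polar coordinates along an integral curve avoiding the origin. -/
theorem IsIntegralCurve.exists_polar_lift {γ : ℝ → ℝ × ℝ}
    (hγ : IsIntegralCurve γ (fun _ => dampedField c)) (h0 : ∀ t, γ t ≠ 0) :
    ∃ ℓ θ : ℝ → ℝ, (∀ t, γ t = polarPoint (ℓ t) (θ t)) ∧
      (∀ t, ℓ t = Real.log ((γ t).1 ^ 2 + (γ t).2 ^ 2) / 2) ∧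
      (∀ t, HasDerivAt ℓ (damping c (γ t).1 * Real.cos (θ t) ^ 2) t) ∧
      ∀ t, HasDerivAt θ (angularSpeed c (γ t)) t := by
  have hE : ∀ t, 0 < (γ t).1 ^ 2 + (γ t).2 ^ 2 := fun t => sq_add_sq_pos_of_ne_zero (h0 t)
  have hw : Continuous fun t => angularSpeed c (γ t) := continuous_angularSpeed hγ.continuous h0
  -- The angle is measured from the positive `y`-axis, so the initial angle is the argument of `y +
  -- ix`.
  let ζ : ℂ := ⟨(γ 0).2, (γ 0).1⟩
  let ℓ : ℝ → ℝ := fun t => Real.log ((γ t).1 ^ 2 + (γ t).2 ^ 2) / 2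
  let θ : ℝ → ℝ := fun t => ζ.arg + ∫ σ in (0 : ℝ)..t, angularSpeed c (γ σ)
  have hθ : ∀ t, HasDerivAt θ (angularSpeed c (γ t)) t := fun t =>
    ((hw.integral_hasStrictDerivAt 0 t).hasDerivAt).const_add _
  have hℓ : ∀ t, HasDerivAt ℓ
      (damping c (γ t).1 * ((γ t).2 ^ 2 / ((γ t).1 ^ 2 + (γ t).2 ^ 2))) t := by
    intro t
    have h1 := (((hγ.hasDerivAt_fst t).pow 2).add ((hγ.hasDerivAt_snd t).pow 2)).log (hE t).ne'
    refine (h1.div_const 2).congr_deriv ?_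
    have := (hE t).ne'
    simp only [Pi.add_apply, Pi.pow_apply]
    field_simp
    push_cast
    ring
  have hexp : ∀ t, Real.exp (ℓ t) ^ 2 = (γ t).1 ^ 2 + (γ t).2 ^ 2 := by
    intro t
    rw [← Real.exp_nat_mul]
    simp only [ℓ]
    rw [show ((2 : ℕ) : ℝ) * (Real.log ((γ t).1 ^ 2 + (γ t).2 ^ 2) / 2) =
      Real.log ((γ t).1 ^ 2 + (γ t).2 ^ 2) by push_cast; ring, Real.exp_log (hE t)]
  -- The angle is defined by integrating its speed. The point, rotated by this angle and normalised,
  -- is then conserved, with initial coordinates `0` and `1`; this proves the polar formula for all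
  -- times.
  have hA : ∀ t, ((γ t).1 * Real.cos (θ t) - (γ t).2 * Real.sin (θ t)) * Real.exp (-ℓ t) =
      ((γ 0).1 * Real.cos (θ 0) - (γ 0).2 * Real.sin (θ 0)) * Real.exp (-ℓ 0) := by
    intro t
    refine eq_of_hasDerivAt_zero (f := fun t => ((γ t).1 * Real.cos (θ t) -
      (γ t).2 * Real.sin (θ t)) * Real.exp (-ℓ t)) (fun t => ?_) t 0
    refine (((hγ.hasDerivAt_fst t).mul (hθ t).cos).sub
      ((hγ.hasDerivAt_snd t).mul (hθ t).sin)).mul (hℓ t).neg.exp |>.congr_deriv ?_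
    have := (hE t).ne'
    simp only [angularSpeed, Pi.sub_apply, Pi.mul_apply]
    field_simp
    ring
  have hB : ∀ t, ((γ t).1 * Real.sin (θ t) + (γ t).2 * Real.cos (θ t)) * Real.exp (-ℓ t) =
      ((γ 0).1 * Real.sin (θ 0) + (γ 0).2 * Real.cos (θ 0)) * Real.exp (-ℓ 0) := by
    intro t
    refine eq_of_hasDerivAt_zero (f := fun t => ((γ t).1 * Real.sin (θ t) +
      (γ t).2 * Real.cos (θ t)) * Real.exp (-ℓ t)) (fun t => ?_) t 0
    refine (((hγ.hasDerivAt_fst t).mul (hθ t).sin).add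
      ((hγ.hasDerivAt_snd t).mul (hθ t).cos)).mul (hℓ t).neg.exp |>.congr_deriv ?_
    have := (hE t).ne'
    simp only [angularSpeed, Pi.add_apply, Pi.mul_apply]
    field_simp
    ring
  have hθ0 : θ 0 = ζ.arg := by simp [θ]
  have hnorm : ‖ζ‖ = Real.exp (ℓ 0) := by
    have h1 : ‖ζ‖ ^ 2 = Real.exp (ℓ 0) ^ 2 := by
      rw [hexp, Complex.sq_norm, Complex.normSq_apply]
      simp only [ζ]
      ring
    exact (sq_eq_sq₀ (norm_nonneg _) (Real.exp_pos _).le).1 h1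
  have hx0 : (γ 0).1 = Real.exp (ℓ 0) * Real.sin (θ 0) := by
    rw [hθ0, ← hnorm, Complex.norm_mul_sin_arg]
  have hy0 : (γ 0).2 = Real.exp (ℓ 0) * Real.cos (θ 0) := by
    rw [hθ0, ← hnorm, Complex.norm_mul_cos_arg]
  have hpt : ∀ t, γ t = polarPoint (ℓ t) (θ t) := by
    intro t
    have hsc := Real.sin_sq_add_cos_sq (θ t)
    have hsc0 := Real.sin_sq_add_cos_sq (θ 0)
    have hee : Real.exp (ℓ t) * Real.exp (-ℓ t) = 1 := by rw [← Real.exp_add]; simp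
    have hee0 : Real.exp (ℓ 0) * Real.exp (-ℓ 0) = 1 := by rw [← Real.exp_add]; simp
    have hA' : (γ t).1 * Real.cos (θ t) - (γ t).2 * Real.sin (θ t) = 0 := by
      have h1 := hA t
      rw [hx0, hy0] at h1
      have h2 : ((γ t).1 * Real.cos (θ t) - (γ t).2 * Real.sin (θ t)) * Real.exp (-ℓ t) = 0 := by
        rw [h1]; ring
      exact (mul_eq_zero.1 h2).resolve_right (Real.exp_pos _).ne'
    have hB' : (γ t).1 * Real.sin (θ t) + (γ t).2 * Real.cos (θ t) = Real.exp (ℓ t) := by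
      have h1 := hB t
      rw [hx0, hy0] at h1
      have h2 : ((γ t).1 * Real.sin (θ t) + (γ t).2 * Real.cos (θ t)) * Real.exp (-ℓ t) = 1 := by
        rw [h1]
        linear_combination hee0 + Real.exp (ℓ 0) * Real.exp (-ℓ 0) * hsc0
      linear_combination Real.exp (ℓ t) * h2 -
        ((γ t).1 * Real.sin (θ t) + (γ t).2 * Real.cos (θ t)) * hee
    refine Prod.ext ?_ ?_
    · simp only [polarPoint]
      linear_combination Real.cos (θ t) * hA' + Real.sin (θ t) * hB' - (γ t).1 * hsc
    · simp only [polarPoint]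
      linear_combination Real.cos (θ t) * hB' - Real.sin (θ t) * hA' - (γ t).2 * hsc
  refine ⟨ℓ, θ, hpt, fun t => rfl, fun t => (hℓ t).congr_deriv ?_, hθ⟩
  congr 1
  rw [← hexp t]
  have h2 : (γ t).2 = Real.exp (ℓ t) * Real.cos (θ t) := congrArg Prod.snd (hpt t)
  have := (Real.exp_pos (ℓ t)).ne'
  rw [h2]
  field_simp

/-- A nonconstant periodic integral curve along which the damping is small winds once around the
origin. -/
theorem IsIntegralCurve.exists_isPolarOrbit {γ : ℝ → ℝ × ℝ}
    (hγ : IsIntegralCurve γ (fun _ => dampedField c)) {T M : ℝ} (hT : 0 < T)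
    (hper : Function.Periodic γ T) (hne : ∃ s t, γ s ≠ γ t) (hM : ∀ t, ‖γ t‖ ≤ M)
    (hq : ∀ t, |damping c (γ t).1| ≤ 1 / 2) :
    ∃ u, IsPolarOrbit c u ∧ Set.range γ = polarOrbit u := by
  have h0 : ∀ t, γ t ≠ 0 := by
    intro t ht
    have hz : IsIntegralCurve (fun _ : ℝ => (0 : ℝ × ℝ)) (fun _ => dampedField c) :=
      isIntegralCurve_const fun t => by simp [dampedField]
    have hM0 : 0 ≤ M := (norm_nonneg _).trans (hM 0)
    have heq := hγ.eq_of_eq_at hz hM (by simpa using hM0) (t₀ := t) ht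
    obtain ⟨s, t, hst⟩ := hne
    exact hst (by rw [heq])
  obtain ⟨ℓ, θ, hpt, hℓ, hℓ', hθ'⟩ := hγ.exists_polar_lift h0
  obtain ⟨τ, hτ₁, hτ₂, hτ'⟩ := exists_hasDerivAt_inverse (by norm_num : (0 : ℝ) < 1 / 2) hθ'
    fun t => le_angularSpeed (h0 t) (hq t)
  have hw : ∀ t, 0 < angularSpeed c (γ t) := fun t =>
    lt_of_lt_of_le (by norm_num) (le_angularSpeed (h0 t) (hq t))
  have hshift : ∀ S, (∀ t, γ (t + S) = γ t) → ∀ t₀ s,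
      ℓ (τ (s + (θ (t₀ + S) - θ t₀))) = ℓ (τ s) := by
    intro S hS t₀ s
    have h1 := eq_add_of_periodic_deriv hθ' (T := S) (fun t => by rw [hS]) t₀ (τ s)
    rw [hτ₁] at h1
    rw [← h1, hτ₂, hℓ, hℓ, hS]
  let u : ℝ → ℝ := fun s => ℓ (τ s)
  have hu : ∀ s, HasDerivAt u (damping c (γ (τ s)).1 * Real.cos s ^ 2 *
      (angularSpeed c (γ (τ s)))⁻¹) s := by
    intro s
    have := (hℓ' (τ s)).comp s (hτ' s)
    rwa [hτ₁] at this
  have hpt' : ∀ s, γ (τ s) = polarPoint (u s) s := fun s => by rw [hpt, hτ₁]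
  have hucont : Continuous u := continuous_iff_continuousAt.2 fun s => (hu s).continuousAt
  -- One period of `γ` advances the angle by a positive multiple of `2π`, giving closure after `n`
  -- turns.
  obtain ⟨n, hn0, hn⟩ : ∃ n : ℕ, 0 < n ∧ ∀ s, u (s + n * (2 * Real.pi)) = u s := by
    have h1 : polarPoint (ℓ T) (θ T) = polarPoint (ℓ 0) (θ 0) := by
      rw [← hpt, ← hpt, ← hper 0, zero_add]
    have h2 : ℓ T = ℓ 0 := by rw [hℓ, hℓ, ← hper 0, zero_add]
    have he := (Real.exp_pos (ℓ 0)).ne'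
    rw [h2] at h1
    have hsin := mul_left_cancel₀ he (congrArg Prod.fst h1)
    have hcos := mul_left_cancel₀ he (congrArg Prod.snd h1)
    have h3 : Real.cos (θ T - θ 0) = 1 := by
      rw [Real.cos_sub, hsin, hcos]
      linear_combination Real.sin_sq_add_cos_sq (θ 0)
    obtain ⟨n, hn⟩ := (Real.cos_eq_one_iff _).1 h3
    have hlt : θ 0 < θ T := strictMono_of_hasDerivAt_pos hθ' hw hT
    have hn0 : 0 < n := by
      by_contra hcon
      have : (n : ℝ) ≤ 0 := by exact_mod_cast not_lt.1 hcon
      nlinarith [Real.pi_pos]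
    lift n to ℕ using hn0.le
    refine ⟨n, by exact_mod_cast hn0, fun s => ?_⟩
    have := hshift T hper 0 s
    rw [zero_add, ← hn] at this
    exact_mod_cast this
  -- The increments over `n` successive turns add up to zero, so they cannot all have one strict
  -- sign; the intermediate value theorem yields a turn that closes, and uniqueness then makes every
  -- turn close.
  obtain ⟨s₀, hs₀⟩ : ∃ s, u (s + 2 * Real.pi) - u s = 0 := by
    have hsum : ∑ j ∈ Finset.range n,
        (u (2 * Real.pi * j + 2 * Real.pi) - u (2 * Real.pi * j)) = 0 := by
      have := Finset.sum_range_sub (fun j : ℕ => u (2 * Real.pi * j)) n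
      have h2 := hn 0
      rw [zero_add, mul_comm] at h2
      simp only [Nat.cast_zero, mul_zero, h2, sub_self] at this
      rw [← this]
      refine Finset.sum_congr rfl fun j _ => ?_
      push_cast
      ring_nf
    have hne : (Finset.range n).Nonempty := Finset.nonempty_range_iff.2 hn0.ne'
    have hcont : Continuous fun s => u (s + 2 * Real.pi) - u s := by fun_prop
    have := mem_range_of_exists_le_of_exists_ge hcont (c := 0) ?_ ?_
    · exact this
    · by_contra! hcon
      exact (Finset.sum_pos (fun j (_ : j ∈ Finset.range n) => hcon (2 * Real.pi * j)) hne).ne'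
        hsum
    · by_contra! hcon
      exact (Finset.sum_neg (fun j (_ : j ∈ Finset.range n) => hcon (2 * Real.pi * j)) hne).ne
        hsum
  have hperiod : Function.Periodic u (2 * Real.pi) := by
    let S := τ (s₀ + 2 * Real.pi) - τ s₀
    have h1 : γ (τ s₀ + S) = γ (τ s₀) := by
      have : τ s₀ + S = τ (s₀ + 2 * Real.pi) := by simp [S]
      rw [this, hpt', hpt', sub_eq_zero.1 hs₀]
      simp [polarPoint]
    have h2 : γ ∘ (· + S) = γ := IsIntegralCurve.eq_of_eq_at (hγ.comp_add S) hγ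
      (fun t => hM _) hM (t₀ := τ s₀) h1
    have h3 := hshift S (fun t => congrFun h2 t) (τ s₀)
    have h4 : θ (τ s₀ + S) - θ (τ s₀) = 2 * Real.pi := by
      have : τ s₀ + S = τ (s₀ + 2 * Real.pi) := by simp [S]
      rw [this, hτ₁, hτ₁]; ring
    rw [h4] at h3
    exact h3
  refine ⟨u, ⟨fun s => ⟨_, hu s, ?_⟩, hperiod⟩, ?_⟩
  · have hwn := (hw (τ s)).ne'
    have h1 := angularSpeed_polarPoint (c := c) (u s) s
    rw [← hpt'] at h1
    have h2 : Real.exp (u s) * Real.sin s = (γ (τ s)).1 := by rw [hpt']; rfl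
    rw [h2] at h1 ⊢
    field_simp
    linear_combination (-(damping c (γ (τ s)).1 * Real.cos s ^ 2)) * h1
  · ext z
    constructor
    · rintro ⟨t, rfl⟩
      exact ⟨θ t, by simp only; rw [← hpt', hτ₂]⟩
    · rintro ⟨s, rfl⟩
      exact ⟨τ s, hpt' s⟩

end Planar

/-! ### From polar curves back to periodic orbits. -/

section Orbits

variable {m : ℕ} {c : Fin m → ℝ} {u : ℝ → ℝ}

theorem IsPolarOrbit.continuous (hu : IsPolarOrbit c u) : Continuous u :=
  continuous_iff_continuousAt.2 fun s => (hu.exists_deriv s).choose_spec.1.continuousAt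

theorem continuous_polarPoint : Continuous fun q : ℝ × ℝ => polarPoint q.1 q.2 := by
  unfold polarPoint
  fun_prop

theorem polarPoint_add_two_pi (r s : ℝ) : polarPoint r (s + 2 * Real.pi) = polarPoint r s := by
  simp [polarPoint]

/-- Negating the damping reflects the speed about `1`, so the lower bound also gives the upper one.
-/
theorem angularSpeed_le {z : ℝ × ℝ} (hz : z ≠ 0) (hq : |damping c z.1| ≤ 1 / 2) :
    angularSpeed c z ≤ 2 := by
  have h := le_angularSpeed (c := -c) hz (by simpa [damping, Finset.sum_neg_distrib] using hq)
  have h2 : angularSpeed (-c) z = 2 - angularSpeed c z := by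
    simp [angularSpeed, damping, Finset.sum_neg_distrib]
    ring
  linarith

/-- A closed polar curve solving the radial equation is a periodic orbit. -/
theorem IsPolarOrbit.isPeriodicOrbit (hu : IsPolarOrbit c u)
    (hq : ∀ s, |damping c (Real.exp (u s) * Real.sin s)| ≤ 1 / 2) :
    IsPeriodicOrbit (dampedField c) (polarOrbit u) := by
  have hucont := hu.continuous
  have hnz : ∀ s, polarPoint (u s) s ≠ 0 := fun s => polarPoint_ne_zero _ _
  let w : ℝ → ℝ := fun s => angularSpeed c (polarPoint (u s) s)
  have hwcont : Continuous w := continuous_angularSpeed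
    (continuous_polarPoint.comp (hucont.prodMk continuous_id)) hnz
  have hw : ∀ s, 1 / 2 ≤ w s := fun s => le_angularSpeed (hnz s) (hq s)
  have hw0 : ∀ s, 0 < w s := fun s => lt_of_lt_of_le (by norm_num) (hw s)
  have hw2 : ∀ s, w s ≤ 2 := fun s => angularSpeed_le (hnz s) (hq s)
  -- `ψ` is the time needed to reach angle `s`; its inverse `τ` is the angle as a function of time,
  -- and `ψ (2π)` is the period.
  let ψ : ℝ → ℝ := fun s => ∫ σ in (0 : ℝ)..s, (w σ)⁻¹
  have hψ : ∀ s, HasDerivAt ψ (w s)⁻¹ s := fun s =>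
    ((hwcont.inv₀ fun s => (hw0 s).ne').integral_hasStrictDerivAt 0 s).hasDerivAt
  obtain ⟨τ, hτ₁, hτ₂, hτ'⟩ := exists_hasDerivAt_inverse (by norm_num : (0 : ℝ) < 1 / 2) hψ
    fun s => by
      rw [one_div]
      exact inv_anti₀ (hw0 s) (hw2 s)
  have hwper : ∀ s, (w (s + 2 * Real.pi))⁻¹ = (w s)⁻¹ := fun s => by
    simp only [w, hu.periodic s, polarPoint_add_two_pi]
  have hψ0 : ψ 0 = 0 := by simp [ψ]
  have hψmono : StrictMono ψ := strictMono_of_hasDerivAt_pos hψ fun s => inv_pos.2 (hw0 s)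
  have hτper : ∀ t, τ (t + ψ (2 * Real.pi)) = τ t + 2 * Real.pi := fun t => by
    have := eq_add_of_periodic_deriv hψ hwper 0 (τ t)
    rw [hψ0, zero_add, sub_zero, hτ₁] at this
    rw [← this, hτ₂]
  refine ⟨fun t => polarPoint (u (τ t)) (τ t), fun t => ?_, ⟨ψ (2 * Real.pi), ?_, fun t => ?_⟩,
    ⟨ψ 0, ψ Real.pi, ?_⟩, ?_⟩
  · obtain ⟨g, hg, hgeq⟩ := hu.exists_deriv (τ t)
    have h1 := angularSpeed_polarPoint (c := c) (u (τ t)) (τ t)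
    have hτt := hτ' t
    rw [inv_inv] at hτt
    have h2 : HasDerivAt (fun t => u (τ t)) (g * w (τ t)) t := hg.comp t hτt
    have h3 := (h2.exp.mul hτt.sin).prodMk (h2.exp.mul hτt.cos)
    refine h3.congr_deriv ?_
    have hsc := Real.sin_sq_add_cos_sq (τ t)
    simp only [dampedField, polarPoint, w] at h1 ⊢
    set q := damping c (Real.exp (u (τ t)) * Real.sin (τ t)) with hqdef
    have hgw : g * angularSpeed c (Real.exp (u (τ t)) * Real.sin (τ t),
        Real.exp (u (τ t)) * Real.cos (τ t)) = q * Real.cos (τ t) ^ 2 := by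
      rw [h1]; linear_combination hgeq
    rw [hgw, h1]
    refine Prod.ext ?_ ?_
    · simp only
      ring
    · simp only
      linear_combination Real.exp (u (τ t)) * q * Real.cos (τ t) * hsc
  · rw [← hψ0]
    exact hψmono (by positivity)
  · simp only [hτper, hu.periodic _, polarPoint_add_two_pi]
  · simp only [hτ₂]
    intro h
    have := congrArg Prod.snd h
    simp only [polarPoint, Real.cos_zero, Real.cos_pi] at this
    linarith [Real.exp_pos (u 0), Real.exp_pos (u Real.pi)]
  · ext z
    constructor
    · rintro ⟨s, rfl⟩
      exact ⟨ψ s, by simp only [hτ₂]⟩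
    · rintro ⟨t, rfl⟩
      exact ⟨τ t, rfl⟩

/-- Periodic orbits with a common point coincide. -/
theorem IsPeriodicOrbit.eq_of_mem {Γ₁ Γ₂ : Set (ℝ × ℝ)}
    (h₁ : IsPeriodicOrbit (dampedField c) Γ₁) (h₂ : IsPeriodicOrbit (dampedField c) Γ₂)
    {z : ℝ × ℝ} (hz₁ : z ∈ Γ₁) (hz₂ : z ∈ Γ₂) : Γ₁ = Γ₂ := by
  obtain ⟨γ₁, hγ₁, ⟨T₁, hT₁, hp₁⟩, -, rfl⟩ := h₁
  obtain ⟨γ₂, hγ₂, ⟨T₂, hT₂, hp₂⟩, -, rfl⟩ := h₂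
  obtain ⟨a, rfl⟩ := hz₁
  obtain ⟨b, hb⟩ := hz₂
  obtain ⟨M₁, hM₁⟩ := (hp₁.isBounded_of_continuous hT₁.ne' hγ₁.continuous).exists_norm_le
  obtain ⟨M₂, hM₂⟩ := (hp₂.isBounded_of_continuous hT₂.ne' hγ₂.continuous).exists_norm_le
  have h := IsIntegralCurve.eq_of_eq_at (hγ₁.comp_add a) (hγ₂.comp_add b) (M := max M₁ M₂)
    (fun t => (hM₁ _ ⟨_, rfl⟩).trans (le_max_left _ _))
    (fun t => (hM₂ _ ⟨_, rfl⟩).trans (le_max_right _ _)) (t₀ := 0) (by simp [hb])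
  have key : ∀ t, γ₁ (t + a) = γ₂ (t + b) := fun t => congrFun h t
  ext z
  constructor
  · rintro ⟨t, rfl⟩
    exact ⟨t - a + b, by rw [← key]; simp⟩
  · rintro ⟨t, rfl⟩
    exact ⟨t - b + a, by rw [key]; simp⟩

/-- The curve can meet the positive `y`-axis only at multiples of `2π`, where periodicity gives the
same radius. -/
theorem eq_zero_of_polarPoint_mem_polarOrbit (hu : Function.Periodic u (2 * Real.pi)) {r : ℝ}
    (h : polarPoint r 0 ∈ polarOrbit u) : r = u 0 := by
  obtain ⟨s, hs⟩ := h
  have h1 := congrArg Prod.fst hs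
  have h2 := congrArg Prod.snd hs
  simp only [polarPoint, Real.sin_zero, Real.cos_zero, mul_zero, mul_one] at h1 h2
  have hsin : Real.sin s = 0 := (mul_eq_zero.1 h1).resolve_left (Real.exp_pos _).ne'
  have hcos : Real.cos s = 1 := by
    rcases Real.sin_eq_zero_iff_cos_eq.1 hsin with h | h
    · exact h
    · rw [h] at h2
      linarith [Real.exp_pos (u s), Real.exp_pos r]
  obtain ⟨n, hn⟩ := (Real.cos_eq_one_iff s).1 hcos
  rw [hcos, mul_one] at h2
  rw [← Real.exp_injective h2, ← hn]
  simpa using hu.int_mul n 0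

end Orbits

/-! ### Rescaling, reflection and the implicit equation. -/

section Scaling

variable {m : ℕ}

/-- The coefficients of the equation for orbits rescaled by `exp t`. -/
noncomputable def scaledCoeff (c : Fin m → ℝ) (t : ℝ) : Fin m → ℝ :=
  fun k => c k * Real.exp ((k : ℕ) * t)

theorem damping_scaledCoeff (c : Fin m → ℝ) (t x : ℝ) :
    damping (scaledCoeff c t) x = damping c (Real.exp t * x) := by
  refine Finset.sum_congr rfl fun k _ => ?_
  rw [scaledCoeff, Real.exp_nat_mul]
  ring

theorem abs_damping_le (c : Fin m → ℝ) {x X : ℝ} (hX : 1 ≤ X) (hx : |x| ≤ X) :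
    |damping c x| ≤ m * (‖c‖ * X ^ m) := by
  refine (Finset.abs_sum_le_sum_abs _ _).trans ?_
  refine (Finset.sum_le_card_nsmul _ _ (‖c‖ * X ^ m) fun k _ => ?_).trans (by simp)
  rw [abs_mul, abs_pow]
  gcongr
  · exact norm_le_pi_norm c k
  · exact (pow_le_pow_left₀ (abs_nonneg x) hx _).trans (pow_le_pow_right₀ hX k.2.le)

theorem norm_scaledCoeff_mono (c : Fin m → ℝ) : Monotone fun t => ‖scaledCoeff c t‖ := by
  intro s t hst
  refine (pi_norm_le_iff_of_nonneg (norm_nonneg _)).2 fun k => ?_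
  refine le_trans ?_ (norm_le_pi_norm (scaledCoeff c t) k)
  simp only [scaledCoeff, norm_mul, Real.norm_eq_abs, Real.abs_exp]
  gcongr

/-- The generator of the rescaling of coefficients. -/
noncomputable def scalingGenerator (m : ℕ) : (Fin m → ℝ) →L[ℝ] (Fin m → ℝ) :=
  ContinuousLinearMap.pi fun k => ((k : ℕ) : ℝ) • ContinuousLinearMap.proj k

/-- This is what makes the zero count applicable: changing the starting radius moves the
coefficients along a linear flow. -/
theorem hasDerivAt_scaledCoeff (c : Fin m → ℝ) (t : ℝ) :
    HasDerivAt (scaledCoeff c) (scalingGenerator m (scaledCoeff c t)) t := by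
  refine hasDerivAt_pi.2 fun k => ?_
  refine ((((hasDerivAt_id t).const_mul ((k : ℕ) : ℝ)).exp).const_mul (c k)).congr_deriv ?_
  simp [scalingGenerator, scaledCoeff]
  ring

/-- The coefficients of `-damping c (-x)`: even coefficients change sign. -/
noncomputable def reflectCoeff (m : ℕ) : (Fin m → ℝ) →L[ℝ] (Fin m → ℝ) :=
  ContinuousLinearMap.pi fun k => ((-1 : ℝ) ^ ((k : ℕ) + 1)) • ContinuousLinearMap.proj k

theorem reflectCoeff_apply (c : Fin m → ℝ) (k : Fin m) :
    reflectCoeff m c k = (-1) ^ ((k : ℕ) + 1) * c k := by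
  simp [reflectCoeff]

theorem damping_reflectCoeff (c : Fin m → ℝ) (x : ℝ) :
    damping (reflectCoeff m c) x = -damping c (-x) := by
  simp only [damping, reflectCoeff_apply, ← Finset.sum_neg_distrib]
  refine Finset.sum_congr rfl fun k _ => ?_
  rw [neg_pow x]
  ring

theorem scaledCoeff_reflectCoeff (c : Fin m → ℝ) (t : ℝ) :
    scaledCoeff (reflectCoeff m c) t = reflectCoeff m (scaledCoeff c t) := by
  ext k
  simp only [scaledCoeff, reflectCoeff_apply]
  ring

theorem norm_reflectCoeff (c : Fin m → ℝ) : ‖reflectCoeff m c‖ = ‖c‖ := by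
  simp [Pi.norm_def, reflectCoeff_apply, nnnorm_mul]

/-- The substitution `(x, y, time) ↦ (-x, y, -time)` preserves the form of the system and changes
the damping to `-damping c (-x)`. A backward half turn thus becomes a forward one. -/
theorem IsPolarOrbit.comp_neg {c : Fin m → ℝ} {u : ℝ → ℝ} (hu : IsPolarOrbit c u) :
    IsPolarOrbit (reflectCoeff m c) (fun s => u (-s)) := by
  constructor
  · intro s
    obtain ⟨g, hg, hgeq⟩ := hu.exists_deriv (-s)
    refine ⟨-g, ?_, ?_⟩
    · exact (hg.comp s (hasDerivAt_neg s)).congr_deriv (by ring)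
    · rw [damping_reflectCoeff]
      rw [Real.sin_neg, Real.cos_neg, mul_neg] at hgeq
      linear_combination -hgeq
  · intro s
    have := hu.periodic (-s - 2 * Real.pi)
    simp only [sub_add_cancel] at this
    simp only [this]
    ring_nf

theorem polarDefect_apply (p : Fin m → ℝ) (G : ℝ →ᵇ ℝ) (s : ℝ) :
    polarDefect (p, G) s = G s -
      damping p (Real.exp (foldIntegral G s) * Real.sin (foldAngle s)) *
        (Real.cos s ^ 2 + Real.sin (foldAngle s) * Real.cos s * G s) := by
  simp only [polarDefect, polarTerm, damping, BoundedContinuousFunction.coe_sub, Pi.sub_apply,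
    BoundedContinuousFunction.sum_apply, BoundedContinuousFunction.smul_apply,
    BoundedContinuousFunction.mul_apply, BoundedContinuousFunction.pow_apply,
    BoundedContinuousFunction.add_apply, BoundedContinuousFunction.exp_apply, sinFold_apply,
    cosBounded_apply, Finset.sum_mul, smul_eq_mul]
  congr 1
  refine Finset.sum_congr rfl fun k _ => ?_
  ring

/-- The derivative of a polar orbit over a half turn solves the implicit equation. -/
theorem IsPolarOrbit.exists_polarDefect_eq_zero {c : Fin m → ℝ} {u : ℝ → ℝ}
    (hu : IsPolarOrbit c u) {η : ℝ} (hη : η ≤ 1 / 2)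
    (hq : ∀ s, |damping c (Real.exp (u s) * Real.sin s)| ≤ η) :
    ∃ G : ℝ →ᵇ ℝ, ‖G‖ ≤ 2 * η ∧ polarDefect (scaledCoeff c (u 0), G) = 0 ∧
      foldIntegral G Real.pi = u Real.pi - u 0 := by
  choose g hg hgeq using hu.exists_deriv
  have hucont := hu.continuous
  have hη0 : 0 ≤ η := (abs_nonneg _).trans (hq 0)
  have hsc : ∀ s, |Real.sin s * Real.cos s| ≤ 1 := fun s => by
    rw [abs_mul]
    exact mul_le_one₀ (Real.abs_sin_le_one s) (abs_nonneg _) (Real.abs_cos_le_one s)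
  have hqsc : ∀ s, |damping c (Real.exp (u s) * Real.sin s) * (Real.sin s * Real.cos s)| ≤ η :=
    fun s => by
      rw [abs_mul]
      exact (mul_le_mul (hq s) (hsc s) (abs_nonneg _) hη0).trans (mul_one η).le
  have hden : ∀ s, 1 / 2 ≤
      1 - damping c (Real.exp (u s) * Real.sin s) * (Real.sin s * Real.cos s) := fun s => by
    linarith [(abs_le.1 (hqsc s)).2]
  have hgform : g = fun s => damping c (Real.exp (u s) * Real.sin s) * Real.cos s ^ 2 /
      (1 - damping c (Real.exp (u s) * Real.sin s) * (Real.sin s * Real.cos s)) := by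
    funext s
    rw [eq_div_iff (by linarith [hden s])]
    linear_combination hgeq s
  have hgcont : Continuous g := by
    rw [hgform]
    have hd := continuous_damping c
    have h1 : Continuous fun s => damping c (Real.exp (u s) * Real.sin s) :=
      hd.comp (by fun_prop)
    exact (h1.mul (by fun_prop)).div (continuous_const.sub (h1.mul (by fun_prop)))
      fun s => by linarith [hden s]
  have hgbound : ∀ s, |g s| ≤ 2 * η := by
    intro s
    have hd := hden s
    have hqs := hq s
    rw [hgform]
    simp only
    rw [abs_div, abs_of_pos (show 0 < 1 - damping c (Real.exp (u s) * Real.sin s) *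
      (Real.sin s * Real.cos s) by linarith), div_le_iff₀ (by linarith), abs_mul,
      abs_of_nonneg (sq_nonneg (Real.cos s))]
    have hc : Real.cos s ^ 2 ≤ 1 := Real.cos_sq_le_one s
    have h1 := mul_le_mul hqs hc (sq_nonneg _) hη0
    nlinarith
  -- Only `g` on `[0, π]` matters; folding extends it to a bounded function that solves the equation
  -- at every `s`.
  let G : ℝ →ᵇ ℝ := BoundedContinuousFunction.ofNormedAddCommGroup (fun s => g (foldAngle s))
    (hgcont.comp continuous_foldAngle) (2 * η) fun s => hgbound _
  have hint : ∀ s, foldIntegral G s = u (foldAngle s) - u 0 := by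
    intro s
    have h1 : ∫ σ in (0 : ℝ)..foldAngle s, g σ = u (foldAngle s) - u 0 :=
      intervalIntegral.integral_eq_sub_of_hasDerivAt (fun x _ => hg x)
        (hgcont.intervalIntegrable _ _)
    rw [foldIntegral_apply, ← h1]
    refine intervalIntegral.integral_congr fun σ hσ => ?_
    rw [Set.uIcc_of_le (foldAngle_nonneg s)] at hσ
    have : foldAngle σ = σ := foldAngle_of_mem hσ.1 (hσ.2.trans (foldAngle_le_pi s))
    simp [G, this]
  refine ⟨G, BoundedContinuousFunction.norm_ofNormedAddCommGroup_le _ (by positivity)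
    (fun s => hgbound _), ?_, ?_⟩
  · ext s
    rw [polarDefect_apply, damping_scaledCoeff, hint, ← mul_assoc, ← Real.exp_add]
    have h1 := hgeq (foldAngle s)
    rw [cos_foldAngle] at h1
    have h2 : G s = g (foldAngle s) := rfl
    rw [h2, add_sub_cancel, BoundedContinuousFunction.coe_zero, Pi.zero_apply]
    linear_combination h1
  · rw [hint, foldAngle_of_mem Real.pi_pos.le le_rfl]

/-- The folded angle is `s` or `-s` modulo `2π`, as the two have the same cosine. -/
theorem apply_foldAngle_of_even_of_periodic {H : ℝ → ℝ} (heven : ∀ s, H (-s) = H s)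
    (hper : Function.Periodic H (2 * Real.pi)) (s : ℝ) : H (foldAngle s) = H s := by
  obtain ⟨k, hk | hk⟩ := Real.cos_eq_cos_iff.1 (cos_foldAngle s)
  · have := hper.int_mul k (foldAngle s)
    rw [← this]
    exact congrArg H (by linarith)
  · have := hper.int_mul k (-foldAngle s)
    rw [← heven, ← this]
    exact congrArg H (by linarith)

/-- When the damping is odd, every small solution of the implicit equation gives a closed orbit. -/
theorem isPolarOrbit_of_polarDefect_eq_zero {c : Fin m → ℝ} (hc : reflectCoeff m c = c) {t : ℝ}
    {G : ℝ →ᵇ ℝ} (hG : polarDefect (scaledCoeff c t, G) = 0)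
    (hq : ∀ s, |damping c (Real.exp (t + foldIntegral G s) * Real.sin s)| ≤ 1 / 2) :
    IsPolarOrbit c fun s => t + foldIntegral G s := by
  have hodd : ∀ x, damping c (-x) = -damping c x := fun x => by
    have := damping_reflectCoeff c x
    rw [hc] at this
    rw [this, neg_neg]
  set v : ℝ → ℝ := fun s => t + foldIntegral G s with hv
  have hfold : ∀ s s', Real.cos s = Real.cos s' → v s = v s' := fun s s' h => by
    simp only [hv, foldIntegral_apply, foldAngle, h]
  have hvneg : ∀ s, v (-s) = v s := fun s => hfold _ _ (Real.cos_neg s)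
  have hvper : ∀ s, v (s + 2 * Real.pi) = v s := fun s => hfold _ _ (Real.cos_add_two_pi s)
  have hvcont : Continuous v := continuous_const.add (foldIntegral G).continuous
  let q : ℝ → ℝ := fun s => damping c (Real.exp (v s) * Real.sin s)
  have hqcont : Continuous q := (continuous_damping c).comp (by fun_prop)
  have hqneg : ∀ s, q (-s) = -q s := fun s => by
    simp only [q, hvneg, Real.sin_neg, mul_neg, hodd]
  have hqper : ∀ s, q (s + 2 * Real.pi) = q s := fun s => by
    simp only [q, hvper, Real.sin_add_two_pi]
  have hden : ∀ s, 0 < 1 - q s * (Real.sin s * Real.cos s) := by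
    intro s
    have h1 : |Real.sin s * Real.cos s| ≤ 1 := by
      rw [abs_mul]
      exact mul_le_one₀ (Real.abs_sin_le_one s) (abs_nonneg _) (Real.abs_cos_le_one s)
    have h2 := mul_le_mul (hq s) h1 (abs_nonneg _) (by norm_num)
    rw [← abs_mul] at h2
    have := (abs_le.1 h2).2
    simp only [q, hv]
    linarith
  -- This is the equation solved for the derivative, valid on both half turns. Odd damping and even
  -- `v` make `g` odd, so its primitive `H` is even and its integral over a full turn vanishes;
  -- hence `H` is the folded integral of `G`.
  let g : ℝ → ℝ := fun s => q s * Real.cos s ^ 2 / (1 - q s * (Real.sin s * Real.cos s))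
  have hgcont : Continuous g := by
    refine (hqcont.mul (by fun_prop)).div (continuous_const.sub (hqcont.mul (by fun_prop)))
      fun s => (hden s).ne'
  have hgneg : ∀ s, g (-s) = -g s := fun s => by
    simp only [g, hqneg, Real.sin_neg, Real.cos_neg]
    ring
  have hgper : Function.Periodic g (2 * Real.pi) := fun s => by
    simp only [g, hqper, Real.sin_add_two_pi, Real.cos_add_two_pi]
  let H : ℝ → ℝ := fun s => ∫ σ in (0 : ℝ)..s, g σ
  have hHeven : ∀ s, H (-s) = H s := by
    intro s
    have h1 := intervalIntegral.integral_comp_neg (f := g) (a := 0) (b := s)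
    simp only [hgneg, neg_zero, intervalIntegral.integral_neg] at h1
    simp only [H]
    rw [intervalIntegral.integral_symm, ← h1, neg_neg]
  have hHper : Function.Periodic H (2 * Real.pi) := by
    intro s
    have hint := fun a b => hgcont.intervalIntegrable (μ := MeasureTheory.volume) a b
    have h1 : H (s + 2 * Real.pi) = H s + ∫ σ in s..s + 2 * Real.pi, g σ :=
      (intervalIntegral.integral_add_adjacent_intervals (hint _ _) (hint _ _)).symm
    have h2 := hgper.intervalIntegral_add_eq s (-Real.pi)
    have h3 : ∫ σ in -Real.pi..-Real.pi + 2 * Real.pi, g σ = H Real.pi - H (-Real.pi) := by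
      rw [show -Real.pi + 2 * Real.pi = Real.pi by ring]
      exact (intervalIntegral.integral_interval_sub_left (hint _ _) (hint _ _)).symm
    rw [h1, h2, h3, hHeven, sub_self, add_zero]
  have hGg : ∀ s, 0 ≤ s → s ≤ Real.pi → G s = g s := by
    intro s hs0 hs1
    have h1 := polarDefect_apply (scaledCoeff c t) G s
    rw [hG, foldAngle_of_mem hs0 hs1, damping_scaledCoeff, ← mul_assoc, ← Real.exp_add,
      BoundedContinuousFunction.coe_zero, Pi.zero_apply] at h1
    simp only [g]
    rw [eq_div_iff (hden s).ne']
    simp only [q, hv]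
    linear_combination -h1
  have hHv : ∀ s, foldIntegral G s = H s := by
    intro s
    rw [← apply_foldAngle_of_even_of_periodic hHeven hHper s, foldIntegral_apply]
    refine intervalIntegral.integral_congr fun σ hσ => ?_
    rw [Set.uIcc_of_le (foldAngle_nonneg s)] at hσ
    exact hGg σ hσ.1 (hσ.2.trans (foldAngle_le_pi s))
  have hvH : v = fun s => t + H s := funext fun s => by simp only [hv, hHv]
  refine ⟨fun s => ⟨g s, ?_, ?_⟩, hvper⟩
  · rw [hvH]
    exact ((hgcont.integral_hasStrictDerivAt 0 s).hasDerivAt).const_add t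
  · have h1 : g s * (1 - q s * (Real.sin s * Real.cos s)) = q s * Real.cos s ^ 2 :=
      div_mul_cancel₀ _ (hden s).ne'
    simp only [q] at h1
    linear_combination h1

end Scaling

/-! ### Periodic orbits in small discs. -/

/-- The disc of radius `exp t` about the origin. -/
def logDisc (t : ℝ) : Set (ℝ × ℝ) := {z | z.1 ^ 2 + z.2 ^ 2 < Real.exp t ^ 2}

theorem logDisc_mem_nhds (t : ℝ) : logDisc t ∈ 𝓝 (0 : ℝ × ℝ) := by
  have h : IsOpen (logDisc t) := isOpen_lt (by fun_prop) continuous_const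
  exact h.mem_nhds (by simpa [logDisc] using pow_pos (Real.exp_pos t) 2)

section Orbits

variable {m : ℕ} {c : Fin m → ℝ}

theorem IsPeriodicOrbit.exists_isPolarOrbit {Γ : Set (ℝ × ℝ)}
    (hΓ : IsPeriodicOrbit (dampedField c) Γ) {t : ℝ} (hsub : Γ ⊆ logDisc t)
    (hq : ∀ x, |x| ≤ Real.exp t → |damping c x| ≤ 1 / 2) :
    ∃ u, IsPolarOrbit c u ∧ Γ = polarOrbit u ∧ ∀ s, u s < t := by
  obtain ⟨γ, hγ, ⟨T, hT, hper⟩, hne, rfl⟩ := hΓ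
  have hdisc : ∀ τ, (γ τ).1 ^ 2 + (γ τ).2 ^ 2 < Real.exp t ^ 2 := fun τ => hsub ⟨τ, rfl⟩
  have hx : ∀ τ, |(γ τ).1| ≤ Real.exp t := fun τ =>
    abs_le_of_sq_le_sq (by nlinarith [hdisc τ, sq_nonneg (γ τ).2]) (Real.exp_pos t).le
  obtain ⟨M, hM⟩ := (hper.isBounded_of_continuous hT.ne' hγ.continuous).exists_norm_le
  obtain ⟨u, hu, hrange⟩ := hγ.exists_isPolarOrbit hT hper hne (fun τ => hM _ ⟨τ, rfl⟩)
    fun τ => hq _ (hx τ)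
  refine ⟨u, hu, hrange, fun s => ?_⟩
  have h1 : polarPoint (u s) s ∈ logDisc t := hsub (hrange ▸ ⟨s, rfl⟩)
  have h2 : Real.exp (u s) ^ 2 < Real.exp t ^ 2 := by
    refine lt_of_eq_of_lt ?_ h1
    simp only [polarPoint]
    linear_combination -Real.exp (u s) ^ 2 * Real.sin_sq_add_cos_sq s
  exact Real.exp_lt_exp.1 (lt_of_pow_lt_pow_left₀ 2 (Real.exp_pos t).le h2)

/-- There is no periodic orbit along which the damping has a strict sign. -/
theorem not_isPeriodicOrbit_of_damping_pos {Γ : Set (ℝ × ℝ)} {a : ℝ}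
    (hsign : ∀ z ∈ Γ, 0 < a * damping c z.1) : ¬IsPeriodicOrbit (dampedField c) Γ := by
  rintro ⟨γ, hγ, ⟨T, hT, hper⟩, ⟨t₁, t₂, hne⟩, rfl⟩
  -- The derivative `2 a q y²` is nonnegative and `f` is periodic, so `f` is constant. Then `y = 0`
  -- throughout, and `x' = y` makes the curve constant.
  let f : ℝ → ℝ := fun t => a * ((γ t).1 ^ 2 + (γ t).2 ^ 2)
  have hf : ∀ t, HasDerivAt f (2 * (a * damping c (γ t).1) * (γ t).2 ^ 2) t := by
    intro t
    refine ((((hγ.hasDerivAt_fst t).pow 2).add ((hγ.hasDerivAt_snd t).pow 2)).const_mul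
      a).congr_deriv ?_
    push_cast
    ring
  have hmono : Monotone f := monotone_of_hasDerivAt_nonneg hf fun t => by
    have := hsign _ ⟨t, rfl⟩
    simp only [Pi.zero_apply]
    positivity
  have hfper : Function.Periodic f T := fun t => by simp only [f, hper t]
  have hconst : ∀ s t, s ≤ t → f s = f t := by
    intro s t hst
    obtain ⟨n, hn⟩ := exists_nat_ge ((t - s) / T)
    rw [div_le_iff₀ hT] at hn
    have h1 := hmono (show t ≤ s + n * T by linarith)
    rw [hfper.nat_mul n s] at h1
    exact le_antisymm (hmono hst) h1
  have hfeq : ∀ s t, f s = f t := fun s t => (le_total s t).elim (hconst s t)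
    fun h => (hconst t s h).symm
  have hy : ∀ t, (γ t).2 = 0 := by
    intro t
    have h1 : HasDerivAt f 0 t := by
      have : f = fun _ => f 0 := funext fun s => hfeq s 0
      rw [this]
      exact hasDerivAt_const _ _
    have h2 := (hf t).unique h1
    have h3 := hsign _ ⟨t, rfl⟩
    have h4 := (mul_eq_zero.1 h2).resolve_left (by positivity)
    exact pow_eq_zero_iff (two_ne_zero) |>.1 h4
  refine hne (Prod.ext ?_ (by rw [hy, hy]))
  exact eq_of_hasDerivAt_zero (fun t => hy t ▸ hγ.hasDerivAt_fst t) t₁ t₂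

end Orbits

/-! ### The closing condition and the reversible case. -/

section HalfTurn

variable {m : ℕ}

/-- A solution operator of the implicit equation for scaled coefficients of norm less than `δ`. -/
structure IsHalfTurnSolution (δ : ℝ) (γ : (Fin m → ℝ) → (ℝ →ᵇ ℝ)) : Prop where
  continuousAt : ∀ p, ‖p‖ < δ → ContinuousAt γ p
  polarDefect_eq_zero : ∀ p, ‖p‖ < δ → polarDefect (p, γ p) = 0
  norm_foldIntegral_le : ∀ p, ‖p‖ < δ → ‖foldIntegral (γ p)‖ ≤ 1
  eq_of_polarDefect_eq_zero : ∀ p G, ‖p‖ < δ → ‖G‖ ≤ 2 * (m * δ) → polarDefect (p, G) = 0 → γ p = G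
  small : m * (δ * 3 ^ m) ≤ 1 / 2

theorem IsHalfTurnSolution.small_one {δ : ℝ} (hδ : 0 < δ) {γ : (Fin m → ℝ) → (ℝ →ᵇ ℝ)}
    (h : IsHalfTurnSolution δ γ) : m * δ ≤ 1 / 2 := by
  refine le_trans ?_ h.small
  have : (1 : ℝ) ≤ 3 ^ m := one_le_pow₀ (by norm_num)
  gcongr
  nlinarith

-- Every clause is local at the origin. The bound `2 * (m * δ)` is the one that
-- `IsPolarOrbit.exists_polarDefect_eq_zero` gives for orbits with damping at most `m * δ`, so their
-- derivatives fall in the uniqueness neighbourhood.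
open scoped ContDiff in
theorem eventually_isHalfTurnSolution {γ : (Fin m → ℝ) → (ℝ →ᵇ ℝ)} (hγ : ContDiffAt ℝ ω γ 0)
    (hγ0 : γ 0 = 0)
    (hiff : ∀ᶠ q in 𝓝 (0 : (Fin m → ℝ) × (ℝ →ᵇ ℝ)), polarDefect q = 0 ↔ γ q.1 = q.2) :
    ∀ᶠ δ : ℝ in 𝓝[>] 0, IsHalfTurnSolution δ γ := by
  have h1 : ∀ᶠ p in 𝓝 (0 : Fin m → ℝ), ContinuousAt γ p ∧ polarDefect (p, γ p) = 0 ∧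
      ‖foldIntegral (γ p)‖ ≤ 1 := by
    refine ((hγ.eventually (by simp)).mono fun p hp => hp.continuousAt).and (.and ?_ ?_)
    · have hc : Tendsto (fun p => (p, γ p)) (𝓝 0) (𝓝 (0 : (Fin m → ℝ) × (ℝ →ᵇ ℝ))) := by
        have := (continuousAt_id (x := (0 : Fin m → ℝ))).prodMk hγ.continuousAt
        rwa [ContinuousAt, hγ0] at this
      exact (hc.eventually hiff).mono fun p hp => hp.2 rfl
    · have hc : ContinuousAt (fun p => ‖foldIntegral (γ p)‖) 0 :=
        (foldIntegral.continuous.continuousAt.comp hγ.continuousAt).norm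
      have hlt : ‖foldIntegral (γ 0)‖ < 1 := by simp [hγ0]
      exact (hc.eventually_lt_const hlt).mono fun p hp => hp.le
  obtain ⟨r₁, hr₁, h1⟩ := Metric.eventually_nhds_iff.1 h1
  obtain ⟨r₂, hr₂, h2⟩ := Metric.eventually_nhds_iff.1 hiff
  have e1 : ∀ᶠ δ : ℝ in 𝓝[>] 0, δ < r₁ := nhdsWithin_le_nhds (eventually_lt_nhds hr₁)
  have e2 : ∀ᶠ δ : ℝ in 𝓝[>] 0, δ < r₂ := nhdsWithin_le_nhds (eventually_lt_nhds hr₂)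
  have e3 : ∀ᶠ δ : ℝ in 𝓝[>] 0, 2 * (m * δ) < r₂ := by
    have hc : ContinuousAt (fun δ : ℝ => 2 * (m * δ)) 0 := by fun_prop
    exact nhdsWithin_le_nhds (hc.eventually_lt_const (by simpa using hr₂))
  have e4 : ∀ᶠ δ : ℝ in 𝓝[>] 0, m * (δ * 3 ^ m) < 1 / 2 := by
    have hc : ContinuousAt (fun δ : ℝ => m * (δ * 3 ^ m)) 0 := by fun_prop
    exact nhdsWithin_le_nhds (hc.eventually_lt_const (by simp))
  filter_upwards [e1, e2, e3, e4] with δ d1 d2 d3 d4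
  have h1' : ∀ p : Fin m → ℝ, ‖p‖ < δ → _ := fun p hp =>
    h1 (y := p) (by simpa using hp.trans d1)
  refine ⟨fun p hp => (h1' p hp).1, fun p hp => (h1' p hp).2.1, fun p hp => (h1' p hp).2.2,
    fun p G hp hG h0 => ?_, d4.le⟩
  refine (h2 (y := (p, G)) ?_).1 h0
  rw [dist_zero_right, Prod.norm_def]
  exact max_lt (hp.trans d2) (hG.trans_lt d3)

variable {δ : ℝ} {γ : (Fin m → ℝ) → (ℝ →ᵇ ℝ)} {c : Fin m → ℝ} {u : ℝ → ℝ} {t : ℝ}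

theorem abs_damping_le_of_norm_scaledCoeff_lt (ht : ‖scaledCoeff c t‖ < δ) {x : ℝ}
    (hx : |x| ≤ Real.exp t) : |damping c x| ≤ m * δ := by
  have h1 : damping c x = damping (scaledCoeff c t) (Real.exp (-t) * x) := by
    rw [damping_scaledCoeff, ← mul_assoc, ← Real.exp_add]
    simp
  have h2 : |Real.exp (-t) * x| ≤ 1 := by
    rw [abs_mul, Real.abs_exp, Real.exp_neg, inv_mul_le_iff₀ (Real.exp_pos t), mul_one]
    exact hx
  rw [h1]
  refine (abs_damping_le _ le_rfl h2).trans ?_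
  rw [one_pow, mul_one]
  gcongr

/-- The half turns of a closed orbit, forward and backward in time, end at the same point. -/
theorem IsPolarOrbit.foldIntegral_pi_eq (hu : IsPolarOrbit c u) (hδ : 0 < δ)
    (hγ : IsHalfTurnSolution δ γ) (ht : ‖scaledCoeff c t‖ < δ) (hut : ∀ s, u s < t) :
    foldIntegral (γ (scaledCoeff c (u 0))) Real.pi =
      foldIntegral (γ (reflectCoeff m (scaledCoeff c (u 0)))) Real.pi := by
  have key : ∀ {c : Fin m → ℝ} {u : ℝ → ℝ}, IsPolarOrbit c u → ‖scaledCoeff c t‖ < δ →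
      (∀ s, u s < t) → foldIntegral (γ (scaledCoeff c (u 0))) Real.pi = u Real.pi - u 0 := by
    intro c u hu ht hut
    obtain ⟨G, hG, hG0, hGpi⟩ := hu.exists_polarDefect_eq_zero (hγ.small_one hδ) fun s =>
      abs_damping_le_of_norm_scaledCoeff_lt ht (by
        rw [abs_mul, Real.abs_exp]
        exact (mul_le_of_le_one_right (Real.exp_pos _).le (Real.abs_sin_le_one s)).trans
          (Real.exp_le_exp.2 (hut s).le))
    rw [hγ.eq_of_polarDefect_eq_zero _ G
      ((norm_scaledCoeff_mono c (hut 0).le).trans_lt ht) hG hG0, hGpi]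
  -- The reflected orbit ends its half turn at `s = -π` of the original one, which periodicity
  -- identifies with `s = π`.
  have h2 := key hu.comp_neg (by rwa [scaledCoeff_reflectCoeff, norm_reflectCoeff])
    fun s => hut (-s)
  have h3 := hu.periodic (-Real.pi)
  rw [show -Real.pi + 2 * Real.pi = Real.pi by ring] at h3
  rw [neg_zero, scaledCoeff_reflectCoeff, ← h3] at h2
  rw [key hu ht hut, h2]

/-- Closed orbits of a reversible system form a continuous family. -/
theorem not_isLimitCycle_polarOrbit (hc : reflectCoeff m c = c) (hγ : IsHalfTurnSolution δ γ)
    (hu : IsPolarOrbit c u) (hu0 : ‖scaledCoeff c (u 0)‖ < δ) :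
    ¬IsLimitCycle (dampedField c) (polarOrbit u) := by
  rintro ⟨hΓ, V, hV, hΓV, hiso⟩
  let v : ℝ → ℝ → ℝ := fun t s => t + foldIntegral (γ (scaledCoeff c t)) s
  have hv0 : ∀ t, v t 0 = t := fun t => by
    simp [v, foldIntegral_apply, foldAngle_of_mem le_rfl Real.pi_pos.le]
  have hvq : ∀ t, ‖scaledCoeff c t‖ < δ →
      ∀ s, |damping c (Real.exp (v t s) * Real.sin s)| ≤ 1 / 2 := by
    intro t ht s
    simp only [v]
    rw [Real.exp_add, mul_assoc, ← damping_scaledCoeff]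
    -- The logarithmic radius grows by at most `1`, so the rescaled radius is at most `e < 3`; this
    -- explains the factor `3 ^ m` in `small`.
    refine (abs_damping_le _ (by norm_num : (1 : ℝ) ≤ 3) ?_).trans (le_trans ?_ hγ.small)
    · rw [abs_mul, Real.abs_exp]
      refine (mul_le_of_le_one_right (Real.exp_pos _).le (Real.abs_sin_le_one s)).trans ?_
      have h1 := (foldIntegral (γ (scaledCoeff c t))).norm_coe_le_norm s
      have h2 := (le_abs_self _).trans (h1.trans (hγ.norm_foldIntegral_le _ ht))
      exact (Real.exp_le_exp.2 h2).trans Real.exp_one_lt_three.le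
    · gcongr
  have hvorb : ∀ t, ‖scaledCoeff c t‖ < δ → IsPolarOrbit c (v t) := fun t ht =>
    isPolarOrbit_of_polarDefect_eq_zero hc (hγ.polarDefect_eq_zero _ ht) (hvq t ht)
  have hvper : ∀ t, ‖scaledCoeff c t‖ < δ → IsPeriodicOrbit (dampedField c) (polarOrbit (v t)) :=
    fun t ht => (hvorb t ht).isPeriodicOrbit (hvq t ht)
  have hmem : ∀ t, polarPoint t 0 ∈ polarOrbit (v t) := fun t => ⟨0, by simp only [hv0]⟩
  have hΓeq : polarOrbit (v (u 0)) = polarOrbit u :=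
    (hvper _ hu0).eq_of_mem hΓ (hmem _) ⟨0, rfl⟩
  have hscont : Continuous (scaledCoeff c) :=
    continuous_iff_continuousAt.2 fun t => (hasDerivAt_scaledCoeff c t).continuousAt
  have hsmall : ∀ᶠ t in 𝓝 (u 0), ‖scaledCoeff c t‖ < δ :=
    hscont.norm.continuousAt.eventually_lt_const hu0
  -- Compactness of one turn puts all nearby members of the family inside `V`. Isolation would then
  -- make each of them equal to the given orbit, which meets the positive `y`-axis only once.
  have hnear : ∀ᶠ t in 𝓝 (u 0), ∀ s ∈ Set.Icc 0 (2 * Real.pi), polarPoint (v t s) s ∈ V := by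
    refine isCompact_Icc.eventually_forall_of_forall_eventually fun s _ => ?_
    have h1 : ContinuousAt (fun z : ℝ × ℝ => γ (scaledCoeff c z.1)) (u 0, s) :=
      ContinuousAt.comp (g := γ) (f := fun z : ℝ × ℝ => scaledCoeff c z.1)
        (hγ.continuousAt _ hu0) (hscont.comp continuous_fst).continuousAt
    have h2 : ContinuousAt (fun z : ℝ × ℝ => foldIntegral (γ (scaledCoeff c z.1)) z.2) (u 0, s) :=
      (foldIntegral.continuous.continuousAt.comp h1).eval continuousAt_snd
    have h3 : ContinuousAt (fun z : ℝ × ℝ => polarPoint (v z.1 z.2) z.2) (u 0, s) :=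
      ContinuousAt.comp (g := fun q : ℝ × ℝ => polarPoint q.1 q.2)
        (f := fun z : ℝ × ℝ => (v z.1 z.2, z.2)) continuous_polarPoint.continuousAt
        ((continuousAt_fst.add h2).prodMk continuousAt_snd)
    refine h3.eventually_mem (hV.mem_nhds (hΓV ?_))
    rw [← hΓeq]
    exact ⟨s, rfl⟩
  have hall : ∀ᶠ t in 𝓝 (u 0), t = u 0 := by
    filter_upwards [hsmall, hnear] with t ht htV
    refine eq_zero_of_polarPoint_mem_polarOrbit hu.periodic ?_
    rw [← hiso _ (hvper t ht) ?_]
    · exact hmem t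
    · rintro _ ⟨s, rfl⟩
      have hp : Function.Periodic (fun s => polarPoint (v t s) s) (2 * Real.pi) := fun s => by
        simp only [(hvorb t ht).periodic s, polarPoint_add_two_pi]
      obtain ⟨s', hs', heq⟩ := hp.exists_mem_Ico₀ Real.two_pi_pos s
      simp only at heq ⊢
      rw [heq]
      exact htV s' (Set.Ico_subset_Icc_self hs')
  have hne : ∀ᶠ t in 𝓝[≠] (u 0), t ≠ u 0 := eventually_mem_nhdsWithin
  obtain ⟨t, h1, h2⟩ := (hne.and (nhdsWithin_le_nhds hall)).exists
  exact h1 h2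

end HalfTurn

/-! ### The bound by the number of even coefficients. -/

theorem sub_reflectCoeff_apply {m : ℕ} (p : Fin m → ℝ) (k : Fin m) :
    (p - reflectCoeff m p) k = if Even (k : ℕ) then 2 * p k else 0 := by
  rw [Pi.sub_apply, reflectCoeff_apply]
  split_ifs with h
  · rw [pow_succ, h.neg_one_pow]; ring
  · rw [pow_succ, (Nat.not_even_iff_odd.1 h).neg_one_pow]; ring

open scoped ContDiff in
/-- The number of small limit cycles is less than the number of even coefficients of the damping
that are allowed to be nonzero. -/
theorem exists_encard_limitCyclesIn_logDisc_le (m : ℕ) (I : Finset (Fin m)) :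
    ∃ δ > 0, ∀ (c : Fin m → ℝ) (t : ℝ), ‖scaledCoeff c t‖ < δ →
      (∀ k : Fin m, k ∈ I → Even (k : ℕ)) → (∀ k : Fin m, Even (k : ℕ) → k ∉ I → c k = 0) →
      (limitCyclesIn (dampedField c) (logDisc t)).encard ≤ ((I.card - 1 : ℕ) : ℕ∞) := by
  obtain ⟨γ, hγ, hγ0, hγ', hiff⟩ := exists_polar_solution m
  -- `ev (γ p)` is the gain in logarithmic radius over the half turn.
  let ev : (ℝ →ᵇ ℝ) →L[ℝ] ℝ := (BoundedContinuousFunction.evalCLM ℝ Real.pi).comp foldIntegral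
  have hRγ : ContDiffAt ℝ ω (fun p => ev (γ p)) 0 := ev.contDiff.contDiffAt.comp 0 hγ
  obtain ⟨Φ, hΦ, hΦ0, hΦeq⟩ := exists_increment_eq_clm_apply (reflectCoeff m) hRγ
  let Ψ : Fin m → (Fin m → ℝ) → ℝ := fun k p => Φ p (Pi.single k 1)
  have hΨ : ∀ k ∈ I, ContDiffAt ℝ ∞ (Ψ k) 0 ∧ Ψ k 0 ≠ 0 := by
    intro k _
    refine ⟨hΦ.clm_apply contDiffAt_const, ?_⟩
    have h1 : HasFDerivAt (fun p => ev (γ p)) (ev.comp (fderiv ℝ γ 0)) 0 :=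
      ev.hasFDerivAt.comp 0 (hγ.differentiableAt (by simp)).hasFDerivAt
    have h2 : Ψ k 0 = ∫ s in (0 : ℝ)..Real.pi, Real.sin s ^ (k : ℕ) * Real.cos s ^ 2 := by
      simp only [Ψ]
      rw [hΦ0, h1.fderiv, ContinuousLinearMap.comp_apply, hγ']
      change foldIntegral _ Real.pi = _
      rw [foldIntegral_apply, foldAngle_of_mem Real.pi_pos.le le_rfl]
      refine intervalIntegral.integral_congr fun s hs => ?_
      rw [Set.uIcc_of_le Real.pi_pos.le] at hs
      simp [sinFold_apply, cosBounded_apply, foldAngle_of_mem hs.1 hs.2]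
    rw [h2]
    exact (integral_sin_pow_mul_cos_sq_pos _).ne'
  have hcheb := card_zeros_lt_of_exp_mul (scalingGenerator m) I (fun k => ((k : ℕ) : ℝ)) Ψ
    (fun a _ b _ hab => Fin.ext (Nat.cast_injective hab)) hΨ
  obtain ⟨r, hr, hΦr⟩ := Metric.eventually_nhds_iff.1 hΦeq
  have hlt : ∀ᶠ δ : ℝ in 𝓝[>] 0, δ < r := nhdsWithin_le_nhds (eventually_lt_nhds hr)
  have hpos : ∀ᶠ δ : ℝ in 𝓝[>] 0, 0 < δ := eventually_mem_nhdsWithin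
  obtain ⟨δ, hδcheb, hδr, hδ, hδγ⟩ :=
    (hcheb.and (hlt.and (hpos.and (eventually_isHalfTurnSolution hγ hγ0 hiff)))).exists
  refine ⟨δ, hδ, fun c t ht hI hc => ?_⟩
  have hq : ∀ x, |x| ≤ Real.exp t → |damping c x| ≤ 1 / 2 := fun x hx =>
    (abs_damping_le_of_norm_scaledCoeff_lt ht hx).trans (hδγ.small_one hδ)
  have hpol : ∀ Γ ∈ limitCyclesIn (dampedField c) (logDisc t),
      ∃ u, IsPolarOrbit c u ∧ Γ = polarOrbit u ∧ ∀ s, u s < t := fun Γ hΓ =>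
    hΓ.1.1.exists_isPolarOrbit hΓ.2 hq
  by_cases hcI : ∃ i ∈ I, c i ≠ 0
  · by_contra! hcon
    have hIpos : 0 < I.card := Finset.card_pos.2 ⟨_, hcI.choose_spec.1⟩
    choose! U hU hΓU hUt using hpol
    have hcard : (I.card : ℕ∞) ≤ (limitCyclesIn (dampedField c) (logDisc t)).encard := by
      have := Order.add_one_le_of_lt hcon
      rwa [← ENat.natCast_one, ← ENat.natCast_add, Nat.sub_add_cancel hIpos] at this
    obtain ⟨S, hS, hScard⟩ := Set.exists_subset_encard_eq hcard
    have hSfin : S.Finite := Set.finite_of_encard_eq_coe hScard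
    -- Cycles with the same label share a point of the positive `y`-axis, hence coincide; `I.card`
    -- cycles would thus give `I.card` distinct zeros.
    have hinj : Set.InjOn (fun Γ => U Γ 0) S := by
      intro Γ₁ h₁ Γ₂ h₂ heq
      refine (hS h₁).1.1.eq_of_mem (hS h₂).1.1 (z := polarPoint (U Γ₁ 0) 0) ?_ ?_
      · exact (hΓU _ (hS h₁)) ▸ ⟨0, by rw [← hΓU _ (hS h₁)]⟩
      · simp only at heq
        rw [heq]
        exact (hΓU _ (hS h₂)) ▸ ⟨0, by rw [← hΓU _ (hS h₂)]⟩
    let Z : Finset ℝ := hSfin.toFinset.image fun Γ => U Γ 0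
    have hZcard : Z.card = I.card := by
      rw [Finset.card_image_of_injOn (by simpa using hinj)]
      rw [hSfin.encard_eq_coe_toFinset_card] at hScard
      exact_mod_cast hScard
    refine (hδcheb (scaledCoeff c) (hasDerivAt_scaledCoeff c) (Set.Iio t) Set.ordConnected_Iio
      (fun s hs => (norm_scaledCoeff_mono c (le_of_lt hs)).trans_lt ht) c hcI Z ?_ ?_).ne hZcard
    · intro s hs
      obtain ⟨Γ, hΓ, rfl⟩ := Finset.mem_image.1 (Finset.mem_coe.1 hs)
      exact hUt Γ (hS (hSfin.mem_toFinset.1 hΓ)) 0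
    · intro s hs
      obtain ⟨Γ, hΓ, rfl⟩ := Finset.mem_image.1 hs
      have hΓS := hS (hSfin.mem_toFinset.1 hΓ)
      set p := scaledCoeff c (U Γ 0) with hp
      have hpδ : ‖p‖ < δ := (norm_scaledCoeff_mono c (hUt Γ hΓS 0).le).trans_lt ht
      have h1 := hΦr (y := p) (by simpa using hpδ.trans hδr)
      have h2 := (hU Γ hΓS).foldIntegral_pi_eq hδ hδγ ht (hUt Γ hΓS)
      have h3 : ev (γ p) - ev (γ (reflectCoeff m p)) = 0 := sub_eq_zero.2 h2
      have h4 : Φ p (p - reflectCoeff m p) = ∑ k, (p - reflectCoeff m p) k * Ψ k p := by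
        have := LinearMap.pi_apply_eq_sum_univ (Φ p).toLinearMap (p - reflectCoeff m p)
        refine this.trans (Finset.sum_congr rfl fun k _ => ?_)
        simp only [Ψ, smul_eq_mul, ContinuousLinearMap.coe_coe]
        congr 2
        funext j
        simp [Pi.single_apply, eq_comm]
      rw [h3, h4] at h1
      have h5 : ∑ k, (p - reflectCoeff m p) k * Ψ k p =
          2 * ∑ k ∈ I, c k * Real.exp (((k : ℕ) : ℝ) * U Γ 0) * Ψ k p := by
        rw [Finset.mul_sum, ← Finset.sum_subset (Finset.subset_univ I)]
        · refine Finset.sum_congr rfl fun k hk => ?_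
          rw [sub_reflectCoeff_apply, if_pos (hI k hk), hp, scaledCoeff]
          ring
        · intro k _ hk
          rw [sub_reflectCoeff_apply]
          split_ifs with he
          · rw [hp, scaledCoeff, hc k he hk]
            ring
          · ring
      rw [h5] at h1
      linarith
  -- All even coefficients vanish and there is no limit cycle at all. This also covers empty `I`,
  -- where `I.card - 1` truncates to `0`.
  · push Not at hcI
    have hrefl : reflectCoeff m c = c := by
      refine (sub_eq_zero.1 (funext fun k => ?_)).symm
      rw [sub_reflectCoeff_apply]
      split_ifs with he
      · by_cases hk : k ∈ I
        · simp [hcI k hk]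
        · simp [hc k he hk]
      · rfl
    have hempty : limitCyclesIn (dampedField c) (logDisc t) = ∅ := by
      refine Set.eq_empty_of_forall_notMem fun Γ hΓ => ?_
      obtain ⟨u, hu, rfl, hut⟩ := hpol Γ hΓ
      exact not_isLimitCycle_polarOrbit hrefl hδγ hu
        ((norm_scaledCoeff_mono c (hut 0).le).trans_lt ht) hΓ.1
    simp [hempty]

/-! ### Choice of neighbourhoods and conclusion. -/

theorem tendsto_scaledCoeff_cons_zero {d : ℕ} (lam : Fin d → ℝ) :
    Tendsto (scaledCoeff (Fin.cons 0 lam : Fin (d + 1) → ℝ)) atBot (𝓝 0) := by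
  refine tendsto_pi_nhds.2 fun k => ?_
  refine Fin.cases ?_ (fun i => ?_) k
  · simp [scaledCoeff]
  · have h1 : Tendsto (fun t : ℝ => (((i.succ : Fin (d + 1)) : ℕ) : ℝ) * t) atBot atBot :=
      tendsto_id.const_mul_atBot (by simp; positivity)
    simpa [scaledCoeff] using (Real.tendsto_exp_atBot.comp h1).const_mul (lam i)

theorem continuous_finCons {d : ℕ} :
    Continuous fun p : ℝ × (Fin d → ℝ) => (Fin.cons p.1 p.2 : Fin (d + 1) → ℝ) := by
  refine continuous_pi fun k => ?_
  refine Fin.cases ?_ (fun i => ?_) k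
  · simpa using continuous_fst
  · simp only [Fin.cons_succ]
    fun_prop

theorem card_filter_even_fin (d : ℕ) :
    (Finset.univ.filter fun k : Fin (d + 1) => Even (k : ℕ)).card = d / 2 + 1 := by
  rw [← Finset.card_range (d / 2 + 1)]
  refine Finset.card_bij' (fun k _ => (k : ℕ) / 2)
    (fun j hj => ⟨2 * j, by have := Finset.mem_range.1 hj; omega⟩) ?_ ?_ ?_ ?_
  · intro k _
    have := k.2
    simp only [Finset.mem_range]
    omega
  · intro j _
    simp
  · intro k hk
    obtain ⟨r, hr⟩ := (Finset.mem_filter.1 hk).2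
    ext
    simp only
    omega
  · intro j _
    simp

/-- Uniform bound near a linear center, with prescribed nonzero even coefficients. -/
theorem exists_nhds_encard_limitCyclesIn_le {d : ℕ} (lam : Fin d → ℝ) (I : Finset (Fin (d + 1)))
    (hI : ∀ k ∈ I, Even (k : ℕ)) :
    ∃ U ∈ 𝓝 (0 : ℝ × ℝ), ∃ W ∈ 𝓝 ((0, lam) : ℝ × (Fin d → ℝ)), ∀ p ∈ W,
      (∀ k : Fin (d + 1), Even (k : ℕ) → k ∉ I → (Fin.cons p.1 p.2 : Fin (d + 1) → ℝ) k = 0) →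
      (limitCyclesIn (lienardField p.1 p.2) U).encard ≤ ((I.card - 1 : ℕ) : ℕ∞) := by
  obtain ⟨δ, hδ, h⟩ := exists_encard_limitCyclesIn_logDisc_le (d + 1) I
  have hev : ∀ᶠ t in atBot, ‖scaledCoeff (Fin.cons 0 lam : Fin (d + 1) → ℝ) t‖ < δ := by
    have := (tendsto_scaledCoeff_cons_zero lam).norm
    rw [norm_zero] at this
    exact this.eventually_lt_const hδ
  -- The disc is fixed first, using that the constant coefficient is `0`. For this fixed `t` the
  -- smallness condition is open in the coefficients, so it survives small perturbations, including
  -- those of the constant coefficient.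
  obtain ⟨t, ht⟩ := hev.exists
  have hcont : Continuous fun c : Fin (d + 1) → ℝ => scaledCoeff c t := by
    unfold scaledCoeff
    fun_prop
  refine ⟨logDisc t, logDisc_mem_nhds t,
    {p | ‖scaledCoeff (Fin.cons p.1 p.2 : Fin (d + 1) → ℝ) t‖ < δ},
    (isOpen_lt (hcont.comp continuous_finCons).norm continuous_const).mem_nhds ht,
    fun p hp hpI => ?_⟩
  rw [lienardField_eq_dampedField]
  exact h _ t hp hI hpI

/-- Near a linear part that is not a center there are no periodic orbits. -/
theorem exists_nhds_limitCyclesIn_eq_empty {d : ℕ} {a : ℝ} (ha : a ≠ 0) (lam : Fin d → ℝ) :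
    ∃ U ∈ 𝓝 (0 : ℝ × ℝ), ∃ W ∈ 𝓝 (a, lam), ∀ p ∈ W,
      limitCyclesIn (lienardField p.1 p.2) U = ∅ := by
  have hcont : Continuous fun q : (ℝ × (Fin d → ℝ)) × (ℝ × ℝ) =>
      a * damping (Fin.cons q.1.1 q.1.2 : Fin (d + 1) → ℝ) q.2.1 := by
    simp only [damping, Fin.sum_univ_succ, Fin.cons_zero, Fin.cons_succ]
    fun_prop
  have hpos : ∀ᶠ q in 𝓝 (((a, lam), 0) : (ℝ × (Fin d → ℝ)) × (ℝ × ℝ)),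
      0 < a * damping (Fin.cons q.1.1 q.1.2 : Fin (d + 1) → ℝ) q.2.1 := by
    refine hcont.continuousAt.eventually_const_lt ?_
    simpa [damping, Fin.sum_univ_succ] using mul_self_pos.2 ha
  rw [nhds_prod_eq] at hpos
  obtain ⟨W, hW, U, hU, hWU⟩ := Filter.mem_prod_iff.1 hpos
  refine ⟨U, hU, W, hW, fun p hp => Set.eq_empty_of_forall_notMem fun Γ hΓ => ?_⟩
  rw [lienardField_eq_dampedField] at hΓ
  exact not_isPeriodicOrbit_of_damping_pos (fun z hz => hWU (Set.mk_mem_prod hp (hΓ.2 hz))) hΓ.1.1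

theorem theorem1p4 (d : ℕ) (lam : Fin d → ℝ) :
    (∃ U ∈ 𝓝 (0 : ℝ × ℝ), ∃ W ∈ 𝓝 lam, ∀ mu ∈ W,
      (limitCyclesIn (lienardField 0 mu) U).encard ≤ ((d / 2 - 1 : ℕ) : ℕ∞)) ∧
    (∀ a : ℝ, ∃ U ∈ 𝓝 (0 : ℝ × ℝ), ∃ W ∈ 𝓝 (a, lam), ∀ p ∈ W,
      (limitCyclesIn (lienardField p.1 p.2) U).encard ≤ ((d / 2 : ℕ) : ℕ∞)) := by
  set I : Finset (Fin (d + 1)) := Finset.univ.filter fun k => Even (k : ℕ) with hIdef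
  have hIcard : I.card = d / 2 + 1 := card_filter_even_fin d
  have hI : ∀ k, k ∈ I ↔ Even (k : ℕ) := fun k => by simp [hIdef]
  constructor
  -- Since `a = 0`, the index `0` may be dropped, leaving `d / 2` even indices; truncated
  -- subtraction supplies the maximum with `0`.
  · obtain ⟨U, hU, W, hW, h⟩ := exists_nhds_encard_limitCyclesIn_le lam (I.erase 0)
      fun k hk => (hI k).1 (Finset.mem_of_mem_erase hk)
    have hW' : (fun mu : Fin d → ℝ => ((0 : ℝ), mu)) ⁻¹' W ∈ 𝓝 lam :=
      (Continuous.prodMk_right (0 : ℝ)).continuousAt.preimage_mem_nhds hW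
    refine ⟨U, hU, _, hW', fun mu hmu => ?_⟩
    have h0 : (0 : Fin (d + 1)) ∈ I := (hI 0).2 (by simp)
    have := h _ hmu fun k hk hkI => by
      have hk0 : k = 0 := by
        by_contra hne
        exact hkI (Finset.mem_erase.2 ⟨hne, (hI k).2 hk⟩)
      rw [hk0, Fin.cons_zero]
    rwa [Finset.card_erase_of_mem h0, hIcard, Nat.add_sub_cancel] at this
  · intro a
    by_cases ha : a = 0
    · subst ha
      obtain ⟨U, hU, W, hW, h⟩ := exists_nhds_encard_limitCyclesIn_le lam I fun k => (hI k).1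
      refine ⟨U, hU, W, hW, fun p hp => ?_⟩
      have := h p hp fun k hk hkI => absurd ((hI k).2 hk) hkI
      rwa [hIcard, Nat.add_sub_cancel] at this
    · obtain ⟨U, hU, W, hW, h⟩ := exists_nhds_limitCyclesIn_eq_empty ha lam
      exact ⟨U, hU, W, hW, fun p hp => by simp [h p hp]⟩
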